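/- Notation. Let $d\ge 1$, $0<\beta\le 1$, $a>0$, $b\in\mathbb R$, let $\Omega$ be a compact subset of some $\mathbb R^N$ and let $\Psi=\{\psi_{\mathbf k}\}_{\mathbf k\in\mathbb Z^d}$ be a system of continuous functions $\psi_{\mathbf k}:\Omega\to\mathbb C$. For $\mathbf s\in\mathbb N_0^d$ put $\rho(\mathbf s):=\{\mathbf k\in\mathbb Z^d : [2^{s_i-1}]\le |k_i|<2^{s_i},\ i=1,\dots,d\}$. The class $\mathbf W^{a,b}_{A_\beta}(\Psi)$ consists of all $f$ that have an admissible representation, that is, $$f=\sum_{\mathbf k}a_{\mathbf k}\psi_{\mathbf k},\quad \sum_{\mathbf k}|a_{\mathbf k}|<\infty,\quad \Big(\sum_{\|\mathbf s\|_1=j}\ \sum_{\mathbf k\in\rho(\mathbf s)}|a_{\mathbf k}|^\beta\Big)^{1/\beta}\le 2^{-aj}\max(j,1)^{(d-1)b}\quad (j=0,1,2,\dots).$$ For a probability measure $\mu$ on $\Omega$ and a set $\xi=\{\xi^1,\dots,\xi^m\}\subset\Omega$, $m\ge 1$, let $\mu_\xi:=\frac12\big(\mu+\frac1m\sum_{j=1}^m\delta_{\xi^j}\big)$.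 A greedy-based method in $L_p(\Omega,\mu_\xi)$ is given by finitely many pairwise disjoint finite blocks $\Lambda_1,\dots,\Lambda_J\subset\mathbb Z^d$ and numbers $n_i,m_i\in\mathbb N_0$, none of which depends on $f$. From a representation $f=\sum_{\mathbf k} a_{\mathbf k}\psi_{\mathbf k}$ it produces in each block the terms $a_{\mathbf k}\psi_{\mathbf k}$ at $\min(n_i,|\Lambda_i|)$ indices $\mathbf k\in\Lambda_i$ with the largest $|a_{\mathbf k}|$, and the approximant obtained after $m_i$ iterations of the Weak Chebyshev Greedy Algorithm (with weakness parameter $1$, in the complex space $L_p(\Omega,\mu_\xi)$, with respect to $\{\psi_{\mathbf k}\}_{\mathbf k\in\Lambda_i}$) from the sum of the remaining terms of the block; its output is the sum of all these. An iteration of that algorithm for an element $g$ with current approximant $G$ (initially $0$) takes a norming functional $F$ of $g-G$ (so $\|F\|=1$, $F(g-G)=\|g-G\|$) and an index $\mathbf k\in\Lambda_i$ maximizing $|F(\psi_{\mathbf k})|$, and replaces $G$ by a best approximant of $g$ from the complex span of all $\psi_{\mathbf k}$ chosen so far. Lemma 5.2. Let $1<p<\infty$, $0<\beta\le1$, $a>0$,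 $b\in\mathbb R$, $d\ge1$, and $p^*:=\min(p,2)$. There are constants $c^*=c^*(a,\beta,d,p)>0$ and $C=C(a,b,\beta,d,p)>0$ such that the following holds for every $\Omega$ and $\Psi$ as above with $|\psi_{\mathbf k}(\mathbf x)|\le 1$ for all $\mathbf x\in\Omega$, $\mathbf k\in\mathbb Z^d$, and every $v\in\mathbb N$, $v\ge1$. There is a finite set $Q\subset\mathbb Z^d$ with $|Q|\le v^{c^*}$ such that for every Borel probability measure $\mu$ on $\Omega$ and every nonempty finite $\xi\subset\Omega$ there is a greedy-based method in $L_p(\Omega,\mu_\xi)$ with the following property. For every $f\in\mathbf W^{a,b}_{A_\beta}(\Psi)$ and each of its admissible representations, the method can be carried out, and every output $A_{v,\xi}(f)$ of it (whatever choices are made where they are not unique) is a linear combination of at most $v$ of the functions $\psi_{\mathbf k}$, $\mathbf k\in Q$, and satisfies $$\|f-A_{v,\xi}(f)\|_{L_p(\Omega,\mu_\xi)}\le C\,v^{-a+1/p^*-1/\beta}\,(\log(2v))^{(d-1)(a+b)}.$$ -/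

import Mathlib

open MeasureTheory
open scoped ENNReal

noncomputable section

/-- The dyadic block `ρ(s)`: all `k ∈ ℤ^d` with `[2^(s_i - 1)] ≤ |k_i| < 2^(s_i)` for every `i`.
The integer quotient `2 ^ s / 2` is the integer part of `2^(s-1)`, also for `s = 0`. -/
def dyadicBlock {d : ℕ} (s : Fin d → ℕ) : Finset (Fin d → ℤ) :=
  Fintype.piFinset fun i =>
    (Finset.Ioo (-(2 : ℤ) ^ s i) ((2 : ℤ) ^ s i)).filter fun k => (2 : ℤ) ^ s i / 2 ≤ |k|

/-- The hyperbolic layer: the union of the dyadic blocks `ρ(s)` over `s ∈ ℕ₀^d` with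
`‖s‖₁ = j`. -/
def hyperbolicLayer (d j : ℕ) : Finset (Fin d → ℤ) :=
  (Finset.piAntidiag Finset.univ j).biUnion dyadicBlock

/-- `c` is a family of coefficients of an absolutely convergent representation
`f = ∑ c_k ψ_k` for which the pieces `f_j` of `f` over the hyperbolic layers satisfy
`|f_j|_{A_β} = (∑ |c_k|^β)^(1/β) ≤ 2^(-a j) max(j,1)^((d-1) b)`. -/
structure IsWRepresentation {d : ℕ} {Ω : Type*} [TopologicalSpace Ω] [CompactSpace Ω]
    (a b β : ℝ) (ψ : (Fin d → ℤ) → C(Ω, ℂ)) (f : C(Ω, ℂ)) (c : (Fin d → ℤ) → ℂ) : Prop where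
  summable : Summable fun k => ‖c k‖
  hasSum : HasSum (fun k => c k • ψ k) f
  layer_le : ∀ j : ℕ, (∑ k ∈ hyperbolicLayer d j, ‖c k‖ ^ β) ^ (1 / β) ≤
    (2 : ℝ) ^ (-a * (j : ℝ)) * (max (j : ℝ) 1) ^ (((d : ℝ) - 1) * b)

/-- The class `W^{a,b}_{A_β}(Ψ)`. -/
def WClass {d : ℕ} {Ω : Type*} [TopologicalSpace Ω] [CompactSpace Ω]
    (a b β : ℝ) (ψ : (Fin d → ℤ) → C(Ω, ℂ)) : Set C(Ω, ℂ) :=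
  {f | ∃ c, IsWRepresentation a b β ψ f c}

/-- The measure `μ_ξ = (μ + m⁻¹ ∑ δ_{ξ^j}) / 2`. -/
def measureXi {Ω : Type*} [MeasurableSpace Ω] (μ : Measure Ω) {m : ℕ} (ξ : Fin m → Ω) :
    Measure Ω :=
  (2 : ℝ≥0∞)⁻¹ • (μ + (m : ℝ≥0∞)⁻¹ • ∑ j, Measure.dirac (ξ j))

instance {Ω : Type*} [MeasurableSpace Ω] (μ : Measure Ω) [IsFiniteMeasure μ] {m : ℕ}
    (ξ : Fin m → Ω) : IsFiniteMeasure (measureXi μ ξ) := by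
  refine ⟨?_⟩
  rcases Nat.eq_zero_or_pos m with rfl | hm
  · simp [measureXi, ENNReal.mul_lt_top_iff]
  · simp only [measureXi, Measure.smul_apply, Measure.add_apply, Measure.finsetSum_apply,
      smul_eq_mul]
    refine ENNReal.mul_lt_top (by simp) (ENNReal.add_lt_top.2 ⟨measure_lt_top _ _, ?_⟩)
    refine ENNReal.mul_lt_top ?_ (by simp)
    simp [ENNReal.inv_lt_top, hm]

/-- `h` is the coefficient vector of the `m`-th approximant of some realization of the Weak
Chebyshev Greedy Algorithm with weakness parameter `t` in the complex Banach space `X`, applied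
to `f` with respect to the dictionary `{g_k : k ∈ Λ}`. At step `i` (counted from `0`), `F i` is
a norming functional of the residual `f - G i`, the element `g_(φ i)` is a greedy choice for
it, and `G (i + 1)` is a best approximant of `f` from the span of
`g_(φ 0), …, g_(φ i)`. -/
def IsWCGAOutput {ι X : Type*} [NormedAddCommGroup X] [NormedSpace ℂ X] (t : ℝ) (g : ι → X)
    (Λ : Finset ι) (f : X) (m : ℕ) (h : ι →₀ ℂ) : Prop :=
  ∃ (φ : ℕ → ι) (F : ℕ → StrongDual ℂ X) (G : ℕ → ι →₀ ℂ),
    G 0 = 0 ∧ G m = h ∧ ∀ i < m,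
      (‖F i‖ = 1 ∧
        F i (f - Finsupp.linearCombination ℂ g (G i)) =
          (‖f - Finsupp.linearCombination ℂ g (G i)‖ : ℂ)) ∧
      (φ i ∈ Λ ∧ ∀ k ∈ Λ, t * ‖F i (g k)‖ ≤ ‖F i (g (φ i))‖) ∧
      (G (i + 1) ∈ Finsupp.supported ℂ ℂ (φ '' Set.Iic i) ∧
        ∀ h' ∈ Finsupp.supported ℂ ℂ (φ '' Set.Iic i),
          ‖f - Finsupp.linearCombination ℂ g (G (i + 1))‖ ≤
            ‖f - Finsupp.linearCombination ℂ g h'‖)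

/-- `I` consists of `n` indices from `Λ` (of all of `Λ`, if `Λ` has fewer than `n` elements) at
which the coefficients `c` are largest in absolute value. -/
def IsLargestSelection {ι : Type*} (c : ι → ℂ) (Λ : Finset ι) (n : ℕ) (I : Finset ι) : Prop :=
  I ⊆ Λ ∧ I.card = min n Λ.card ∧ ∀ k ∈ I, ∀ l ∈ Λ, l ∉ I → ‖c l‖ ≤ ‖c k‖

/-- The parameters of a greedy-based method: finitely many pairwise disjoint finite blocks of
indices and, for each block, the number `select j` of largest coefficients to keep and the
number `iterate j` of iterations of the Weak Chebyshev Greedy Algorithm. -/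
structure GreedyScheme (ι : Type*) where
  num : ℕ
  block : Fin num → Finset ι
  disjoint : Pairwise fun i j => Disjoint (block i) (block j)
  select : Fin num → ℕ
  iterate : Fin num → ℕ

/-- `h` is the coefficient vector of an approximant which the scheme `S` produces in `L_p(ν)`
from the coefficients `c`. In every block one keeps the terms `c_k ψ_k` with the largest
coefficients, applies the Weak Chebyshev Greedy Algorithm (with weakness parameter `1`) in
`L_p(ν)`, with respect to the `ψ_k` of the block, to the sum of the other terms of the block,
and one adds up everything obtained. -/
def GreedyScheme.IsOutput {ι Ω : Type*} [DecidableEq ι] [TopologicalSpace Ω] [CompactSpace Ω]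
    [MeasurableSpace Ω] [BorelSpace Ω] (S : GreedyScheme ι) (p : ℝ≥0∞) [Fact (1 ≤ p)]
    (ν : Measure Ω) [IsFiniteMeasure ν] (ψ : ι → C(Ω, ℂ)) (c : ι → ℂ) (h : ι →₀ ℂ) : Prop :=
  ∃ (I : Fin S.num → Finset ι) (G : Fin S.num → ι →₀ ℂ),
    (∀ j, IsLargestSelection c (S.block j) (S.select j) (I j) ∧
      IsWCGAOutput 1 (fun k => ContinuousMap.toLp p ν ℂ (ψ k)) (S.block j)
        (ContinuousMap.toLp p ν ℂ (∑ k ∈ S.block j \ I j, c k • ψ k)) (S.iterate j) (G j)) ∧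
    h = ∑ j, (Finsupp.indicator (I j) (fun k _ => c k) + G j)

end

/-! Write `q = min p 2`. On a single block two effects combine. Keeping the `n` largest coefficients
leaves a remainder whose `ℓ_1` norm is at most `n ^ (1 - 1/β)` times the `ℓ_β` quasinorm of the
block (Stechkin's inequality, `IsLargestSelection.sum_sdiff_le`). Then `n` greedy iterations gain a
further factor of order `n ^ (1/q - 1)` over this `ℓ_1` norm (`IsWCGAOutput.norm_sub_le`). Together
they give `n ^ (-θ)` with `θ = 1/β - 1/q > 0`.

The greedy rate needs only the smoothness inequality `Lp_smooth`, whose constant depends on `p`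
alone. A norming functional of the residual vanishes on the current approximant, so some dictionary
element captures at least the fraction `1/A` of the residual norm, where `A` bounds the `ℓ_1` norm
of the coefficients. A step in that direction lowers the `q`-th power of the norm, and
`rate_of_recurrence` turns the decrease into a rate.

The blocks are the hyperbolic layers. Let `N` be the last level before the size bound for the layers
below it exceeds `v / 2`; these layers are kept entirely. Layer `j ≥ N` receives about `v * 2 ^ (-κ
* (j - N))` terms, which sum to at most `v / 2`. With `κ * θ = a / 2` the layer errors still decay
geometrically, so their sum is comparable to the term at `j = N` (`exists_sum_layer_le`), and `v ≲ 2
^ N * N ^ (d - 1)` converts that term to the required bound (`level_estimates`). Beyond a level `J`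
of order `log v` the weights are at most `1`; those layers are dropped, and their `ℓ_1` norm obeys
the same bound (`hyperbolicScheme_error`). Hence the indices used lie below level `J`, a set of size
polynomial in `v`. The measure enters only through having total mass `1`. -/

/-! ### Power-type smoothness of `L_p` -/

/-- After scaling to `z = t / s`, the bounds `1 ± z ≤ exp (± z)` and `cosh y ≤ exp (y ^ 2 / 2)`
reduce the claim to `exp u ≤ 1 + u * exp u` at `u = r / 2 * z ^ 2`. The factor `s ^ r` replaces a
division by `s`. -/
theorem rpow_add_rpow_le_of_abs_le {r s t : ℝ} (hr : 1 ≤ r) (ht : |t| ≤ s) :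
    ((s + t) ^ r + (s - t) ^ r) * s ^ r ≤
      2 * (s ^ 2 + r / 2 * Real.exp (r / 2) * t ^ 2) ^ r := by
  have hs : 0 ≤ s := (abs_nonneg t).trans ht
  have habs := abs_le.1 ht
  rcases hs.eq_or_lt with rfl | hs
  · rw [Real.zero_rpow (by linarith), mul_zero]
    positivity
  set z := t / s with hz
  have hts : t = s * z := by rw [hz]; field_simp
  have hz1 : -1 ≤ z ∧ z ≤ 1 := by
    constructor
    · rw [hz, le_div_iff₀ hs]; linarith
    · rw [hz, div_le_iff₀ hs]; linarith
  have hzsq : z ^ 2 ≤ 1 := by nlinarith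
  have e1 : (1 + z) ^ r ≤ Real.exp (r * z) := by
    rw [mul_comm, Real.exp_mul]
    exact Real.rpow_le_rpow (by linarith) (by linarith [Real.add_one_le_exp z]) (by linarith)
  have e2 : (1 - z) ^ r ≤ Real.exp (-(r * z)) := by
    rw [show -(r * z) = (-z) * r by ring, Real.exp_mul]
    exact Real.rpow_le_rpow (by linarith) (by linarith [Real.add_one_le_exp (-z)]) (by linarith)
  have e3 : Real.exp (r * z) + Real.exp (-(r * z)) ≤ 2 * Real.exp ((r * z) ^ 2 / 2) := by
    have := Real.cosh_le_exp_half_sq (r * z)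
    rw [Real.cosh_eq] at this
    linarith
  have e4 : Real.exp ((r * z) ^ 2 / 2) = Real.exp (r / 2 * z ^ 2) ^ r := by
    rw [← Real.exp_mul]; ring_nf
  have e5 : Real.exp (r / 2 * z ^ 2) ≤ 1 + r / 2 * Real.exp (r / 2) * z ^ 2 := by
    set u := r / 2 * z ^ 2 with hu
    have h1 : Real.exp u - 1 ≤ u * Real.exp u := by
      have := Real.add_one_le_exp (-u)
      have h2 := mul_le_mul_of_nonneg_left this (Real.exp_pos u).le
      rw [← Real.exp_add] at h2
      simp at h2
      linarith
    have h3 : Real.exp u ≤ Real.exp (r / 2) := Real.exp_le_exp.2 (by rw [hu]; nlinarith)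
    have h4 : u * Real.exp u ≤ u * Real.exp (r / 2) :=
      mul_le_mul_of_nonneg_left h3 (by rw [hu]; positivity)
    have : u * Real.exp (r / 2) = r / 2 * Real.exp (r / 2) * z ^ 2 := by rw [hu]; ring
    linarith
  have e6 : (1 + z) ^ r + (1 - z) ^ r ≤ 2 * (1 + r / 2 * Real.exp (r / 2) * z ^ 2) ^ r := by
    have := Real.rpow_le_rpow (Real.exp_pos _).le e5 (by linarith : (0 : ℝ) ≤ r)
    linarith
  have f1 : (s + t) ^ r = s ^ r * (1 + z) ^ r := by
    rw [← Real.mul_rpow hs.le (by linarith), hts]; ring_nf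
  have f2 : (s - t) ^ r = s ^ r * (1 - z) ^ r := by
    rw [← Real.mul_rpow hs.le (by linarith), hts]; ring_nf
  have f3 : (s ^ 2 + r / 2 * Real.exp (r / 2) * t ^ 2) ^ r =
      s ^ r * s ^ r * (1 + r / 2 * Real.exp (r / 2) * z ^ 2) ^ r := by
    rw [← Real.mul_rpow hs.le hs.le, ← Real.mul_rpow (by positivity) (by positivity), hts]
    ring_nf
  rw [f1, f2, f3]
  have : 0 < s ^ r := by positivity
  nlinarith [mul_le_mul_of_nonneg_left e6 (mul_pos this this).le]

/-- The parallelogram law gives `‖x ± y‖ ^ 2 = s ± t`, so the scalar inequality applies with `r = p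
/ 2`. The bound `t ^ 2 ≤ 4 * ‖x‖ ^ 2 * ‖y‖ ^ 2` turns its constant `p / 4 * exp (p / 4)` into `p *
exp (p / 4)`. -/
theorem norm_add_rpow_add_norm_sub_rpow_le_of_two_le {p : ℝ} (hp : 2 ≤ p) (x y : ℂ) :
    ‖x + y‖ ^ p + ‖x - y‖ ^ p ≤
      2 * (‖x‖ ^ 2 + (1 + p * Real.exp (p / 4)) * ‖y‖ ^ 2) ^ (p / 2) := by
  set s : ℝ := ‖x‖ ^ 2 + ‖y‖ ^ 2 with hs
  set t : ℝ := (‖x + y‖ ^ 2 - ‖x - y‖ ^ 2) / 2 with ht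
  have par := parallelogram_law_with_norm ℝ x y
  have hadd : ‖x + y‖ ^ 2 = s + t := by rw [hs, ht]; nlinarith
  have hsub : ‖x - y‖ ^ 2 = s - t := by rw [hs, ht]; nlinarith
  have hpow : ∀ z : ℂ, ‖z‖ ^ p = (‖z‖ ^ 2) ^ (p / 2) := fun z => by
    rw [← Real.rpow_natCast, ← Real.rpow_mul (norm_nonneg _)]
    congr 1
    push_cast
    ring
  have hts : |t| ≤ s := by
    rw [abs_le]
    constructor <;> nlinarith [sq_nonneg ‖x + y‖, sq_nonneg ‖x - y‖]
  have ht2 : |t| ≤ 2 * (‖x‖ * ‖y‖) := by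
    have h1 : ‖x + y‖ ^ 2 ≤ (‖x‖ + ‖y‖) ^ 2 :=
      pow_le_pow_left₀ (norm_nonneg _) (norm_add_le x y) 2
    have h2 : ‖x - y‖ ^ 2 ≤ (‖x‖ + ‖y‖) ^ 2 :=
      pow_le_pow_left₀ (norm_nonneg _) (norm_sub_le x y) 2
    rw [abs_le]
    constructor <;> nlinarith
  rcases (show 0 ≤ s by positivity).eq_or_lt with h0 | h0
  · have hx : ‖x‖ = 0 := by nlinarith [norm_nonneg x, sq_nonneg ‖x‖, sq_nonneg ‖y‖]
    have hy : ‖y‖ = 0 := by nlinarith [norm_nonneg x, sq_nonneg ‖x‖, sq_nonneg ‖y‖]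
    rw [norm_eq_zero] at hx hy
    subst hx hy
    simp only [add_zero, sub_zero, norm_zero]
    rw [Real.zero_rpow (by linarith), add_zero]
    positivity
  have key := rpow_add_rpow_le_of_abs_le (r := p / 2) (by linarith) hts
  rw [hpow (x + y), hpow (x - y), hadd, hsub]
  refine le_of_mul_le_mul_right (key.trans ?_) (show 0 < s ^ (p / 2) by positivity)
  rw [mul_assoc 2, ← Real.mul_rpow (by positivity) h0.le]
  refine mul_le_mul_of_nonneg_left (Real.rpow_le_rpow (by positivity) ?_ (by linarith)) zero_le_two
  have e0 : Real.exp (p / 2 / 2) = Real.exp (p / 4) := by ring_nf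
  rw [e0]
  set c := Real.exp (p / 4)
  have hc : 0 < c := Real.exp_pos _
  have ht3 : t ^ 2 ≤ 4 * (‖x‖ ^ 2 * ‖y‖ ^ 2) := by
    have := pow_le_pow_left₀ (abs_nonneg t) ht2 2
    rw [sq_abs] at this
    nlinarith
  have hpc : 0 < p * c := by positivity
  have : (‖x‖ ^ 2 + (1 + p * c) * ‖y‖ ^ 2) * s = s ^ 2 + p * c * ‖y‖ ^ 2 * s := by
    rw [hs]; ring
  rw [this]
  have h5 : ‖x‖ ^ 2 ≤ s := by rw [hs]; nlinarith [sq_nonneg ‖y‖]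
  have h6 : ‖x‖ ^ 2 * ‖y‖ ^ 2 ≤ s * ‖y‖ ^ 2 := mul_le_mul_of_nonneg_right h5 (sq_nonneg _)
  nlinarith [mul_le_mul_of_nonneg_left (ht3.trans (mul_le_mul_of_nonneg_left h6 (by norm_num))) hpc.le]

/-- The function `u ^ (p / 2)` is concave and subadditive: concavity averages `‖x ± y‖ ^ 2` to `‖x‖
^ 2 + ‖y‖ ^ 2`, and subadditivity splits that sum. -/
theorem norm_add_rpow_add_norm_sub_rpow_le_of_le_two {p : ℝ} (hp : 1 ≤ p) (hp2 : p ≤ 2)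
    (x y : ℂ) : ‖x + y‖ ^ p + ‖x - y‖ ^ p ≤ 2 * ‖x‖ ^ p + 2 * ‖y‖ ^ p := by
  have par := parallelogram_law_with_norm ℝ x y
  have hpow : ∀ z : ℂ, ‖z‖ ^ p = (‖z‖ ^ 2) ^ (p / 2) := fun z => by
    rw [← Real.rpow_natCast, ← Real.rpow_mul (norm_nonneg _)]
    congr 1
    push_cast
    ring
  have hconc := (Real.concaveOn_rpow (p := p / 2) (by linarith) (by linarith)).2
    (Set.mem_Ici.2 (sq_nonneg ‖x + y‖))
    (Set.mem_Ici.2 (sq_nonneg ‖x - y‖))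
    (show (0 : ℝ) ≤ 1 / 2 by norm_num) (show (0 : ℝ) ≤ 1 / 2 by norm_num) (by norm_num)
  simp only [smul_eq_mul] at hconc
  have hmid : 1 / 2 * ‖x + y‖ ^ 2 + 1 / 2 * ‖x - y‖ ^ 2 = ‖x‖ ^ 2 + ‖y‖ ^ 2 := by nlinarith
  rw [hmid] at hconc
  have hsub := Real.rpow_add_le_add_rpow (sq_nonneg ‖x‖) (sq_nonneg ‖y‖)
    (p := p / 2) (by linarith) (by linarith)
  rw [hpow (x + y), hpow (x - y), hpow x, hpow y]
  linarith

theorem Lp_norm_rpow_eq_integral {α : Type*} [MeasurableSpace α] {ν : Measure α} {p : ℝ≥0∞}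
    [Fact (1 ≤ p)] (hp' : p ≠ ∞) (x : Lp ℂ p ν) :
    ‖x‖ ^ p.toReal = ∫ a, ‖x a‖ ^ p.toReal ∂ν := by
  have h1 : (1 : ℝ≥0∞) ≤ p := Fact.out
  have h0 : p ≠ 0 := (zero_lt_one.trans_le h1).ne'
  have hP : 0 < p.toReal := ENNReal.toReal_pos h0 hp'
  have hint : 0 ≤ ∫ a, ‖x a‖ ^ p.toReal ∂ν := integral_nonneg fun a => by positivity
  rw [Lp.norm_def, (Lp.memLp x).eLpNorm_eq_integral_rpow_norm h0 hp',
    ENNReal.toReal_ofReal (by positivity), ← Real.rpow_mul hint, inv_mul_cancel₀ hP.ne',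
    Real.rpow_one]

theorem Lp_integrable_norm_rpow {α : Type*} [MeasurableSpace α] {ν : Measure α} {p : ℝ≥0∞}
    [Fact (1 ≤ p)] (hp' : p ≠ ∞) (x : Lp ℂ p ν) :
    Integrable (fun a => ‖x a‖ ^ p.toReal) ν := by
  have h1 : (1 : ℝ≥0∞) ≤ p := Fact.out
  exact (Lp.memLp x).integrable_norm_rpow (zero_lt_one.trans_le h1).ne' hp'

theorem Lp_norm_add_rpow_add_norm_sub_rpow_eq {α : Type*} [MeasurableSpace α] {ν : Measure α}
    {p : ℝ≥0∞} [Fact (1 ≤ p)] (hp' : p ≠ ∞) (x y : Lp ℂ p ν) :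
    ‖x + y‖ ^ p.toReal + ‖x - y‖ ^ p.toReal =
      ∫ a, (‖x a + y a‖ ^ p.toReal + ‖x a - y a‖ ^ p.toReal) ∂ν := by
  rw [Lp_norm_rpow_eq_integral hp', Lp_norm_rpow_eq_integral hp', ← integral_add
    (Lp_integrable_norm_rpow hp' _) (Lp_integrable_norm_rpow hp' _)]
  refine integral_congr_ae ?_
  filter_upwards [Lp.coeFn_add x y, Lp.coeFn_sub x y] with a h1 h2
  rw [h1, h2, Pi.add_apply, Pi.sub_apply]

theorem Lp_norm_add_rpow_integrable {α : Type*} [MeasurableSpace α] {ν : Measure α}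
    {p : ℝ≥0∞} [Fact (1 ≤ p)] (hp' : p ≠ ∞) (x y : Lp ℂ p ν) :
    Integrable (fun a => ‖x a + y a‖ ^ p.toReal + ‖x a - y a‖ ^ p.toReal) ν := by
  refine ((Lp_integrable_norm_rpow hp' (x + y)).add
    (Lp_integrable_norm_rpow hp' (x - y))).congr ?_
  filter_upwards [Lp.coeFn_add x y, Lp.coeFn_sub x y] with a h1 h2
  rw [Pi.add_apply, h1, h2, Pi.add_apply, Pi.sub_apply]

theorem Lp_smooth_of_le_two {α : Type*} [MeasurableSpace α] {ν : Measure α} {p : ℝ≥0∞}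
    [Fact (1 ≤ p)] (hp' : p ≠ ∞) (hp2 : p.toReal ≤ 2) (x y : Lp ℂ p ν) :
    ‖x + y‖ ^ p.toReal + ‖x - y‖ ^ p.toReal ≤ 2 * ‖x‖ ^ p.toReal + 2 * ‖y‖ ^ p.toReal := by
  have h1 : 1 ≤ p.toReal := by
    have := ENNReal.toReal_mono hp' (Fact.out : (1 : ℝ≥0∞) ≤ p)
    simpa using this
  rw [Lp_norm_add_rpow_add_norm_sub_rpow_eq hp', Lp_norm_rpow_eq_integral hp' x,
    Lp_norm_rpow_eq_integral hp' y, ← integral_const_mul, ← integral_const_mul, ← integral_add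
    ((Lp_integrable_norm_rpow hp' x).const_mul 2) ((Lp_integrable_norm_rpow hp' y).const_mul 2)]
  refine integral_mono (Lp_norm_add_rpow_integrable hp' x y)
    (((Lp_integrable_norm_rpow hp' x).const_mul 2).add
      ((Lp_integrable_norm_rpow hp' y).const_mul 2)) fun a => ?_
  exact norm_add_rpow_add_norm_sub_rpow_le_of_le_two h1 hp2 (x a) (y a)

/-- Jensen's inequality for the convex combination `X / (X + Y) * (u / X) + Y / (X + Y) * (w / Y)`. -/
theorem add_rpow_le_weighted {r u w X Y : ℝ} (hr : 1 ≤ r) (hu : 0 ≤ u) (hw : 0 ≤ w) (hX : 0 < X)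
    (hY : 0 < Y) : (u + w) ^ r ≤
      (X + Y) ^ r * (X / (X + Y) * (u ^ r / X ^ r) + Y / (X + Y) * (w ^ r / Y ^ r)) := by
  have hconv := (convexOn_rpow hr).2
    (Set.mem_Ici.2 (div_nonneg hu hX.le)) (Set.mem_Ici.2 (div_nonneg hw hY.le))
    (show 0 ≤ X / (X + Y) by positivity) (show 0 ≤ Y / (X + Y) by positivity)
    (by field_simp)
  simp only [smul_eq_mul] at hconv
  rw [Real.div_rpow hu hX.le, Real.div_rpow hw hY.le] at hconv
  have e : u + w = (X + Y) * (X / (X + Y) * (u / X) + Y / (X + Y) * (w / Y)) := by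
    field_simp
  rw [e, Real.mul_rpow (by positivity) (by positivity)]
  exact mul_le_mul_of_nonneg_left hconv (by positivity)

theorem Lp_smooth_of_two_le {α : Type*} [MeasurableSpace α] {ν : Measure α} {p : ℝ≥0∞}
    [Fact (1 ≤ p)] (hp' : p ≠ ∞) (hp2 : 2 ≤ p.toReal) (x y : Lp ℂ p ν) :
    ‖x + y‖ ^ (2 : ℝ) + ‖x - y‖ ^ (2 : ℝ) ≤ 2 * ‖x‖ ^ (2 : ℝ) +
      2 * (1 + p.toReal * Real.exp (p.toReal / 4)) * ‖y‖ ^ (2 : ℝ) := by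
  set P := p.toReal with hP
  set K := 1 + P * Real.exp (P / 4) with hK
  have hK1 : 1 ≤ K := by rw [hK]; have := Real.exp_pos (P / 4); nlinarith
  simp only [Real.rpow_two]
  rcases eq_or_ne x 0 with rfl | hx
  · simp only [zero_add, zero_sub, norm_neg, norm_zero]
    nlinarith [sq_nonneg ‖y‖]
  rcases eq_or_ne y 0 with rfl | hy
  · simp only [add_zero, sub_zero, norm_zero]
    nlinarith
  have hx' := norm_pos_iff.2 hx
  have hy' := norm_pos_iff.2 hy
  set X := ‖x‖ ^ 2 with hX
  set Y := K * ‖y‖ ^ 2 with hY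
  have hX0 : 0 < X := by positivity
  have hY0 : 0 < Y := by positivity
  have hpow : ∀ t : ℝ, 0 ≤ t → (t ^ 2) ^ (P / 2) = t ^ P := fun t ht => by
    rw [← Real.rpow_natCast, ← Real.rpow_mul ht]
    congr 1
    push_cast
    ring
  have hXp : X ^ (P / 2) = ‖x‖ ^ P := hpow _ hx'.le
  have hYp : Y ^ (P / 2) = K ^ (P / 2) * ‖y‖ ^ P := by
    rw [hY, Real.mul_rpow (by linarith) (by positivity), hpow _ hy'.le]
  have hr : 1 ≤ P / 2 := by linarith
  have hKp : 0 < K ^ (P / 2) := by positivity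
  -- This contains Minkowski's inequality in `L_(P/2)` for `‖x a‖ ^ 2` and `K * ‖y a‖ ^ 2`. Jensen
  -- with weights proportional to the norms `X` and `Y` is applied pointwise, and the weighted sum
  -- then integrates to exactly `1`.
  have main : ‖x + y‖ ^ P + ‖x - y‖ ^ P ≤ 2 * (X + Y) ^ (P / 2) := by
    have hi1 := (Lp_integrable_norm_rpow hp' x).const_mul (X / (X + Y) / X ^ (P / 2))
    have hi2 := (Lp_integrable_norm_rpow hp' y).const_mul
      (Y / (X + Y) / Y ^ (P / 2) * K ^ (P / 2))
    have hle : ‖x + y‖ ^ P + ‖x - y‖ ^ P ≤ ∫ a, 2 * (X + Y) ^ (P / 2) *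
        (X / (X + Y) / X ^ (P / 2) * ‖x a‖ ^ P +
          Y / (X + Y) / Y ^ (P / 2) * K ^ (P / 2) * ‖y a‖ ^ P) ∂ν := by
      rw [Lp_norm_add_rpow_add_norm_sub_rpow_eq hp']
      refine integral_mono (Lp_norm_add_rpow_integrable hp' x y)
        ((hi1.add hi2).const_mul _) fun a => ?_
      refine (norm_add_rpow_add_norm_sub_rpow_le_of_two_le hp2 (x a) (y a)).trans ?_
      have := add_rpow_le_weighted hr (sq_nonneg ‖x a‖)
        (show 0 ≤ K * ‖y a‖ ^ 2 by positivity) hX0 hY0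
      rw [hpow _ (norm_nonneg (x a)), Real.mul_rpow (by linarith) (sq_nonneg _),
        hpow _ (norm_nonneg (y a))] at this
      refine (mul_le_mul_of_nonneg_left this zero_le_two).trans (le_of_eq ?_)
      ring
    refine hle.trans (le_of_eq ?_)
    rw [integral_const_mul, integral_add hi1 hi2, integral_const_mul, integral_const_mul,
      ← Lp_norm_rpow_eq_integral hp', ← Lp_norm_rpow_eq_integral hp', hXp, hYp, ← hP]
    have : 0 < ‖x‖ ^ P := by positivity
    have : 0 < ‖y‖ ^ P := by positivity
    field_simp
  -- The power mean inequality passes from exponent `P` back to exponent `2`.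
  have hconv := (convexOn_rpow hr).2
    (Set.mem_Ici.2 (sq_nonneg ‖x + y‖)) (Set.mem_Ici.2 (sq_nonneg ‖x - y‖))
    (show (0 : ℝ) ≤ 1 / 2 by norm_num) (show (0 : ℝ) ≤ 1 / 2 by norm_num) (by norm_num)
  simp only [smul_eq_mul] at hconv
  rw [hpow _ (norm_nonneg _), hpow _ (norm_nonneg _)] at hconv
  have hfin : (1 / 2 * ‖x + y‖ ^ 2 + 1 / 2 * ‖x - y‖ ^ 2) ^ (P / 2) ≤ (X + Y) ^ (P / 2) := by
    linarith
  rw [Real.rpow_le_rpow_iff (by positivity) (by positivity) (by linarith)] at hfin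
  rw [hY] at hfin
  linarith

/-- The spaces `L_p` are uniformly smooth of power type `min p 2`, with a constant that depends
only on `p`. -/
theorem Lp_smooth {α : Type*} [MeasurableSpace α] {ν : Measure α} {p : ℝ≥0∞}
    [Fact (1 ≤ p)] (hp' : p ≠ ∞) (x y : Lp ℂ p ν) :
    ‖x + y‖ ^ min p.toReal 2 + ‖x - y‖ ^ min p.toReal 2 ≤ 2 * ‖x‖ ^ min p.toReal 2 +
      2 * (1 + p.toReal * Real.exp (p.toReal / 4)) * ‖y‖ ^ min p.toReal 2 := by
  rcases le_total p.toReal 2 with h | h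
  · rw [min_eq_left h]
    refine (Lp_smooth_of_le_two hp' h x y).trans ?_
    have h2 : 0 ≤ p.toReal * Real.exp (p.toReal / 4) := by positivity
    have : 0 ≤ ‖y‖ ^ p.toReal := by positivity
    nlinarith
  · rw [min_eq_right h]
    exact Lp_smooth_of_two_le hp' h x y

/-! ### Norming functionals in a uniformly smooth space -/

/-- Bernoulli's inequality: the graph of `u ^ q` lies above its tangent at `s`. If `s + t ≤ 0`, the
left side is already nonpositive. -/
theorem rpow_add_mul_le_rpow {q s t u : ℝ} (hq : 1 < q) (hs : 0 ≤ s) (hu : 0 ≤ u)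
    (h : s + t ≤ u) : s ^ q + q * s ^ (q - 1) * t ≤ u ^ q := by
  rcases hs.eq_or_lt with rfl | hs
  · rw [Real.zero_rpow (by linarith), Real.zero_rpow (by linarith)]
    simpa using Real.rpow_nonneg hu q
  have hsq : s ^ q = s ^ (q - 1) * s := by
    rw [← Real.rpow_add_one hs.ne']; ring_nf
  have hs1 : 0 < s ^ (q - 1) := by positivity
  rcases le_total 0 (s + t) with h0 | h0
  · have hb := one_add_mul_self_le_rpow_one_add (s := t / s)
      (by rw [le_div_iff₀ hs]; linarith) hq.le
    have e : s + t = s * (1 + t / s) := by field_simp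
    have h1 : (s + t) ^ q ≤ u ^ q := Real.rpow_le_rpow h0 h (by linarith)
    have h2 : (s + t) ^ q = s ^ q * (1 + t / s) ^ q := by
      rw [e, Real.mul_rpow hs.le]
      rw [show 1 + t / s = (s + t) / s by field_simp]
      positivity
    have h3 : s ^ q * (1 + q * (t / s)) ≤ s ^ q * (1 + t / s) ^ q :=
      mul_le_mul_of_nonneg_left hb (by positivity)
    have h4 : s ^ q * (1 + q * (t / s)) = s ^ q + q * s ^ (q - 1) * t := by
      rw [hsq]; field_simp
    linarith
  · have : 0 ≤ u ^ q := Real.rpow_nonneg hu q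
    rw [hsq]
    nlinarith [mul_nonneg hs1.le (show 0 ≤ -(s + t) by linarith), mul_pos hs1 hs]

section Smooth

variable {X : Type*} [NormedAddCommGroup X] [NormedSpace ℂ X]

/-- A norming functional supports the ball at `x`, so `‖x + y‖` is bounded below by its
linearization. Smoothness turns this into an upper bound for `‖x - y‖`. -/
theorem norm_sub_rpow_le_of_norming {q K : ℝ} (hq : 1 < q)
    (hX : ∀ x y : X, ‖x + y‖ ^ q + ‖x - y‖ ^ q ≤ 2 * ‖x‖ ^ q + K * ‖y‖ ^ q)
    {x : X} {F : StrongDual ℂ X} (hF : ‖F‖ = 1) (hFx : F x = (‖x‖ : ℂ)) (y : X) :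
    ‖x - y‖ ^ q ≤ ‖x‖ ^ q - q * ‖x‖ ^ (q - 1) * (F y).re + K * ‖y‖ ^ q := by
  have h1 : ‖x‖ + (F y).re ≤ ‖x + y‖ := by
    have h2 : (F (x + y)).re ≤ ‖x + y‖ := by
      refine (Complex.re_le_norm _).trans ?_
      simpa [hF] using F.le_opNorm (x + y)
    rwa [map_add, hFx, Complex.add_re, Complex.ofReal_re] at h2
  have := rpow_add_mul_le_rpow hq (norm_nonneg x) (norm_nonneg (x + y)) h1
  linarith [hX x y]

/-- If `F y ≠ 0`, a step of size `l` along `conj (F y) • y` gains a term linear in `l` and loses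
only `O(l ^ q)`. Since `q > 1`, letting `l → 0` contradicts the minimality of `‖x‖`. -/
theorem norming_apply_eq_zero {q K : ℝ} (hq : 1 < q)
    (hX : ∀ x y : X, ‖x + y‖ ^ q + ‖x - y‖ ^ q ≤ 2 * ‖x‖ ^ q + K * ‖y‖ ^ q)
    {x : X} (hx : x ≠ 0) {F : StrongDual ℂ X} (hF : ‖F‖ = 1) (hFx : F x = (‖x‖ : ℂ)) {y : X}
    (hy : ∀ z : ℂ, ‖x‖ ≤ ‖x - z • y‖) : F y = 0 := by
  by_contra hne
  have hx0 := norm_pos_iff.2 hx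
  have hF0 := norm_pos_iff.2 hne
  set M := K * (‖F y‖ * ‖y‖) ^ q with hM
  set c := q * ‖x‖ ^ (q - 1) * ‖F y‖ ^ 2 with hc
  have hc0 : 0 < c := by positivity
  have key : ∀ l : ℝ, 0 < l → c ≤ M * l ^ (q - 1) := fun l hl => by
    have h1 := norm_sub_rpow_le_of_norming hq hX hF hFx (((l : ℂ) * starRingEnd ℂ (F y)) • y)
    have h2 : ‖x‖ ^ q ≤ ‖x - ((l : ℂ) * starRingEnd ℂ (F y)) • y‖ ^ q :=
      Real.rpow_le_rpow hx0.le (hy _) (by linarith)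
    have h3 : (F (((l : ℂ) * starRingEnd ℂ (F y)) • y)).re = l * ‖F y‖ ^ 2 := by
      rw [map_smul, smul_eq_mul, mul_assoc, mul_comm (starRingEnd ℂ (F y)), Complex.mul_conj,
        ← Complex.ofReal_mul, Complex.ofReal_re, Complex.normSq_eq_norm_sq]
    have h4 : ‖((l : ℂ) * starRingEnd ℂ (F y)) • y‖ ^ q = (‖F y‖ * ‖y‖) ^ q * l ^ (q - 1) * l := by
      rw [norm_smul, norm_mul, Complex.norm_real, RCLike.norm_conj, Real.norm_of_nonneg hl.le,
        mul_assoc, Real.mul_rpow hl.le (by positivity), mul_assoc, ← Real.rpow_add_one hl.ne']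
      ring_nf
    rw [h3, h4] at h1
    refine le_of_mul_le_mul_right ?_ hl
    rw [hc, hM]
    nlinarith
  have hlim : Filter.Tendsto (fun l : ℝ => M * l ^ (q - 1)) (nhdsWithin 0 (Set.Ioi 0)) (nhds 0) := by
    have h1 : Filter.Tendsto (fun l : ℝ => M * l ^ (q - 1)) (nhds 0) (nhds (M * 0 ^ (q - 1))) :=
      (Real.continuousAt_rpow_const 0 (q - 1) (Or.inr (by linarith))).const_mul M
    rw [Real.zero_rpow (by linarith), mul_zero] at h1
    exact h1.mono_left nhdsWithin_le_nhds
  have := ge_of_tendsto hlim (Filter.eventually_of_mem self_mem_nhdsWithin key)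
  linarith

end Smooth

/-! ### Convergence rate of the Chebyshev greedy algorithm -/

theorem mul_le_one_of_recurrence {c : ℝ} (hc : 0 < c) {m : ℕ} {t : ℕ → ℝ}
    (ht : ∀ i ≤ m, 0 ≤ t i) (hrec : ∀ i < m, t (i + 1) ≤ t i * (1 - c * t i)) :
    ∀ i ≤ m, c * t i * i ≤ 1 := by
  intro i
  induction i with
  | zero => intro _; simp
  | succ i ih =>
    intro hi
    have h1 := ih (by omega)
    have h2 := hrec i (by omega)
    set x := c * t i with hx
    have hx0 : 0 ≤ x := mul_nonneg hc.le (ht i (by omega))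
    have h3 : c * t (i + 1) ≤ x * (1 - x) := by
      have := mul_le_mul_of_nonneg_left h2 hc.le
      rw [hx]; linarith
    push_cast
    have h4 : c * t (i + 1) * ((i : ℝ) + 1) ≤ x * (1 - x) * ((i : ℝ) + 1) :=
      mul_le_mul_of_nonneg_right h3 (by positivity)
    refine h4.trans ?_
    rcases le_total 1 x with h5 | h5
    · have : x * (1 - x) ≤ 0 := mul_nonpos_of_nonneg_of_nonpos hx0 (by linarith)
      have : x * (1 - x) * ((i : ℝ) + 1) ≤ 0 := mul_nonpos_of_nonpos_of_nonneg this (by positivity)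
      linarith
    -- Here `x * (1 - x) * (i + 1) = (1 - x) * (x * i) + x * (1 - x) ≤ 1 - x ^ 2`.
    · nlinarith [mul_le_mul_of_nonneg_left h1 (show 0 ≤ 1 - x by linarith), sq_nonneg x]

theorem rate_of_recurrence {q K A : ℝ} (hq : 1 < q) (hq2 : q ≤ 2) (hK : 0 < K) (hA : 0 < A)
    {m : ℕ} (hm : 0 < m) {r : ℕ → ℝ} (hr : ∀ i, 0 ≤ r i)
    (hrec : ∀ i < m, ∀ l : ℝ, 0 ≤ l →
      r (i + 1) ^ q ≤ r i ^ q - q * l * r i ^ q / A + K * l ^ q) :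
    r m ≤ (K * (q - 1) ^ (1 - q)) ^ (1 / q) * A * (m : ℝ) ^ (1 / q - 1) := by
  have hq1 : 0 < q - 1 := by linarith
  set u : ℕ → ℝ := fun i => (r i / A) ^ q with hu
  -- The step `l = A * t i` minimizes the right side of the recurrence over `l`; there `K * t i ^ q
  -- = u i * t i`, which leaves the factor `1 - (q - 1) * t i`.
  set t : ℕ → ℝ := fun i => (u i / K) ^ (1 / (q - 1)) with ht
  have hu0 : ∀ i, 0 ≤ u i := fun i => Real.rpow_nonneg (div_nonneg (hr i) hA.le) _
  have ht0 : ∀ i, 0 ≤ t i := fun i => Real.rpow_nonneg (div_nonneg (hu0 i) hK.le) _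
  have hut : ∀ i, K * t i ^ (q - 1) = u i := fun i => by
    simp only [ht]
    rw [← Real.rpow_mul (div_nonneg (hu0 i) hK.le), one_div_mul_cancel hq1.ne', Real.rpow_one]
    field_simp
  have htq : ∀ i, K * t i ^ q = u i * t i := fun i => by
    rw [← hut i, mul_assoc]
    rcases (ht0 i).eq_or_lt with h | h
    · rw [← h, Real.zero_rpow (by linarith), mul_zero]; simp
    · rw [← Real.rpow_add_one h.ne']; ring_nf
  have hurec : ∀ i < m, u (i + 1) ≤ u i * (1 - (q - 1) * t i) := fun i hi => by
    have h1 := hrec i hi (A * t i) (mul_nonneg hA.le (ht0 i))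
    have hAq : 0 < A ^ q := by positivity
    have e : ∀ j, r j ^ q = u j * A ^ q := fun j => by
      simp only [hu]
      rw [Real.div_rpow (hr j) hA.le]; field_simp
    rw [e, e, Real.mul_rpow hA.le (ht0 i)] at h1
    refine le_of_mul_le_mul_right (h1.trans (le_of_eq ?_)) hAq
    have : K * (A ^ q * t i ^ q) = A ^ q * (u i * t i) := by rw [← htq]; ring
    rw [this]
    field_simp
    ring
  have htrec : ∀ i < m, t (i + 1) ≤ t i * (1 - (q - 1) * t i) := fun i hi => by
    have h1 := hurec i hi
    -- This is where `q ≤ 2` enters: the power `1 / (q - 1)` can be dropped from a factor in `[0,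
    -- 1]`.
    have hexp : 1 ≤ 1 / (q - 1) := by rw [le_div_iff₀ hq1]; linarith
    rcases (hu0 i).eq_or_lt with h0 | h0
    · have h2 : u (i + 1) = 0 := le_antisymm (by rw [← h0, zero_mul] at h1; exact h1) (hu0 _)
      have h3 : ∀ j, u j = 0 → t j = 0 := fun j hj => by
        simp only [ht]; rw [hj, zero_div, Real.zero_rpow (by positivity)]
      rw [h3 _ h2, h3 i h0.symm, zero_mul]
    · have h2 : 0 ≤ 1 - (q - 1) * t i := by
        by_contra hneg
        have := mul_neg_of_pos_of_neg h0 (not_le.1 hneg)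
        linarith [hu0 (i + 1)]
      have h3 : t (i + 1) ≤ (u i / K * (1 - (q - 1) * t i)) ^ (1 / (q - 1)) := by
        refine Real.rpow_le_rpow (div_nonneg (hu0 _) hK.le) ?_ (by positivity)
        rw [div_mul_eq_mul_div]
        gcongr
      rw [Real.mul_rpow (by positivity) h2] at h3
      refine h3.trans (mul_le_mul_of_nonneg_left ?_ (ht0 i))
      calc (1 - (q - 1) * t i) ^ (1 / (q - 1)) ≤ (1 - (q - 1) * t i) ^ (1 : ℝ) :=
            Real.rpow_le_rpow_of_exponent_ge' h2 (by nlinarith [ht0 i]) zero_le_one hexp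
        _ = _ := Real.rpow_one _
  have hfin := mul_le_one_of_recurrence hq1 (fun i _ => ht0 i) htrec m le_rfl
  have hm' : (0 : ℝ) < m := by exact_mod_cast hm
  have htm : t m ≤ ((q - 1) * m)⁻¹ := by
    rw [← one_div, le_div_iff₀ (by positivity)]; linarith
  have hum : u m ≤ K * (q - 1) ^ (1 - q) * (m : ℝ) ^ (1 - q) := by
    rw [← hut m, mul_assoc, ← Real.mul_rpow hq1.le hm'.le]
    refine mul_le_mul_of_nonneg_left ?_ hK.le
    refine (Real.rpow_le_rpow (ht0 m) htm hq1.le).trans (le_of_eq ?_)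
    rw [Real.inv_rpow (by positivity), ← Real.rpow_neg (by positivity)]
    ring_nf
  have hrm : r m / A = u m ^ (1 / q) := by
    simp only [hu]
    rw [← Real.rpow_mul (div_nonneg (hr m) hA.le), mul_one_div_cancel (by linarith), Real.rpow_one]
  have h5 : r m / A ≤ (K * (q - 1) ^ (1 - q) * (m : ℝ) ^ (1 - q)) ^ (1 / q) := by
    rw [hrm]
    exact Real.rpow_le_rpow (hu0 m) hum (by positivity)
  rw [Real.mul_rpow (by positivity) (by positivity), ← Real.rpow_mul hm'.le,
    show (1 - q) * (1 / q) = 1 / q - 1 by field_simp, div_le_iff₀ hA] at h5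
  linarith

section Greedy

variable {ι X : Type*} [NormedAddCommGroup X] [NormedSpace ℂ X]

theorem IsWCGAOutput.support_subset {t : ℝ} {g : ι → X} {Λ : Finset ι} {f : X} {m : ℕ}
    {h : ι →₀ ℂ} (H : IsWCGAOutput t g Λ f m h) : h.support ⊆ Λ ∧ h.support.card ≤ m := by
  classical
  obtain ⟨φ, F, G, hG0, rfl, H⟩ := H
  rcases m with _ | m
  · simp [hG0]
  have h1 := (H m (by omega)).2.2.1
  rw [Finsupp.mem_supported] at h1
  have h2 : (G (m + 1)).support ⊆ (Finset.range (m + 1)).image φ := fun k hk => by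
    obtain ⟨i, hi, rfl⟩ := h1 hk
    exact Finset.mem_image_of_mem _ (Finset.mem_range.2 (by simpa [Nat.lt_succ_iff] using hi))
  constructor
  · intro k hk
    obtain ⟨i, hi, rfl⟩ := Finset.mem_image.1 (h2 hk)
    exact (H i (Finset.mem_range.1 hi)).2.1.1
  · exact (Finset.card_le_card h2).trans (Finset.card_image_le.trans (by simp))

theorem exists_best_approximant (g : ι → X) (s : Set ι) (hs : s.Finite) (f : X) :
    ∃ h ∈ Finsupp.supported ℂ ℂ s, ∀ h' ∈ Finsupp.supported ℂ ℂ s,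
      ‖f - Finsupp.linearCombination ℂ g h‖ ≤ ‖f - Finsupp.linearCombination ℂ g h'‖ := by
  set V := Submodule.span ℂ (g '' s) with hV
  have : FiniteDimensional ℂ V := FiniteDimensional.span_of_finite ℂ (hs.image g)
  have : ProperSpace V := FiniteDimensional.proper ℂ V
  have hlim : Filter.Tendsto (fun y : V => ‖f - y‖) (Filter.cocompact V) Filter.atTop := by
    refine Filter.tendsto_atTop_mono (f := fun y : V => ‖y‖ + -‖f‖) (fun y => ?_)
      (Filter.tendsto_atTop_add_const_right _ _ (tendsto_norm_cocompact_atTop (E := V)))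
    have := norm_sub_norm_le (y : X) f
    rw [norm_sub_rev] at this
    exact this
  obtain ⟨⟨y, hy⟩, hmin⟩ := Continuous.exists_forall_le (by fun_prop) hlim
  have hVs : ∀ y, y ∈ V ↔ _ := fun y => Finsupp.mem_span_image_iff_linearCombination ℂ
  obtain ⟨h, hh, rfl⟩ := (hVs y).1 hy
  exact ⟨h, hh, fun h' hh' => hmin ⟨_, (hVs _).2 ⟨h', hh', rfl⟩⟩⟩

/-- Nontriviality provides a functional of norm one even when the residual is zero. A nonempty
dictionary is needed even for `m = 0`, since the sequence of chosen indices must be defined. -/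
theorem exists_isWCGAOutput [Nontrivial X] (g : ι → X) {Λ : Finset ι} (hΛ : Λ.Nonempty) (f : X)
    (m : ℕ) : ∃ h, IsWCGAOutput 1 g Λ f m h := by
  classical
  induction m with
  | zero =>
    obtain ⟨k, -⟩ := hΛ
    exact ⟨0, fun _ => k, 0, 0, rfl, rfl, by simp⟩
  | succ m ih =>
    obtain ⟨_, φ, F, G, hG0, rfl, H⟩ := ih
    obtain ⟨F', hF', hF'x⟩ := exists_dual_vector' ℂ (f - Finsupp.linearCombination ℂ g (G m))
    obtain ⟨k, hk, hkmax⟩ := Λ.exists_max_image (fun k => ‖F' (g k)‖) hΛ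
    set φ' := Function.update φ m k with hφ'
    have hφ : ∀ i < m, φ' '' Set.Iic i = φ '' Set.Iic i := fun i hi =>
      Set.image_congr fun j hj => Function.update_of_ne (by have := Set.mem_Iic.1 hj; omega) _ _
    obtain ⟨G', hG', hG'min⟩ := exists_best_approximant g (φ' '' Set.Iic m)
      ((Set.finite_Iic m).image _) f
    refine ⟨G', φ', Function.update F m F', Function.update G (m + 1) G', ?_, ?_, ?_⟩
    · rw [Function.update_of_ne (by omega), hG0]
    · rw [Function.update_self]
    intro i hi
    rw [Function.update_of_ne (show i ≠ m + 1 by omega)]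
    rcases (Nat.lt_succ_iff.1 hi).eq_or_lt with rfl | hi
    · simp only [hφ', Function.update_self, one_mul]
      exact ⟨⟨hF', hF'x⟩, ⟨hk, hkmax⟩, hG', hG'min⟩
    · have hφi : φ' i = φ i := Function.update_of_ne hi.ne _ _
      rw [hφ i hi, hφi, Function.update_of_ne hi.ne,
        Function.update_of_ne (show i + 1 ≠ m + 1 by omega)]
      exact H i hi

/-- The rate of convergence of the greedy algorithm on the absolutely convex hull of the
dictionary. -/
theorem IsWCGAOutput.norm_sub_le {q K : ℝ} (hq : 1 < q) (hq2 : q ≤ 2) (hK : 0 < K)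
    (hX : ∀ x y : X, ‖x + y‖ ^ q + ‖x - y‖ ^ q ≤ 2 * ‖x‖ ^ q + K * ‖y‖ ^ q)
    {g : ι → X} (hg : ∀ k, ‖g k‖ ≤ 1) {Λ s : Finset ι} (hs : s ⊆ Λ) (c : ι → ℂ) {A : ℝ}
    (hA : ∑ k ∈ s, ‖c k‖ ≤ A) {m : ℕ} (hm : 0 < m) {h : ι →₀ ℂ}
    (H : IsWCGAOutput 1 g Λ (∑ k ∈ s, c k • g k) m h) :
    ‖(∑ k ∈ s, c k • g k) - Finsupp.linearCombination ℂ g h‖ ≤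
      (K * (q - 1) ^ (1 - q)) ^ (1 / q) * A * (m : ℝ) ^ (1 / q - 1) := by
  obtain ⟨φ, F, G, hG0, rfl, H⟩ := H
  set f := ∑ k ∈ s, c k • g k with hf
  set r : ℕ → ℝ := fun i => ‖f - Finsupp.linearCombination ℂ g (G i)‖ with hr
  have hA0 : 0 ≤ A := (Finset.sum_nonneg fun _ _ => norm_nonneg _).trans hA
  have hfA : ‖f‖ ≤ A := by
    refine (norm_sum_le _ _).trans ((Finset.sum_le_sum fun k _ => ?_).trans hA)
    rw [norm_smul]
    exact mul_le_of_le_one_right (norm_nonneg _) (hg k)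
  rcases hA0.eq_or_lt with rfl | hA0
  · obtain ⟨n, rfl⟩ : ∃ n, m = n + 1 := ⟨m - 1, by omega⟩
    have := (H n (by omega)).2.2.2 0 (Submodule.zero_mem _)
    rw [map_zero, sub_zero] at this
    simpa using this.trans hfA
  refine rate_of_recurrence hq hq2 hK hA0 hm (r := r) (fun i => norm_nonneg _) ?_
  intro i hi l hl
  obtain ⟨⟨hF1, hFx⟩, ⟨-, hmax⟩, -, hbest⟩ := H i hi
  set x := f - Finsupp.linearCombination ℂ g (G i) with hx
  -- The best approximant does at least as well as the old one corrected by any multiple of the new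
  -- element.
  have hstep : ∀ z : ℂ, r (i + 1) ≤ ‖x - z • g (φ i)‖ := fun z => by
    have hmem : G i + Finsupp.single (φ i) z ∈ Finsupp.supported ℂ ℂ (φ '' Set.Iic i) := by
      refine Submodule.add_mem _ ?_ (Finsupp.single_mem_supported ℂ z ⟨i, Set.self_mem_Iic, rfl⟩)
      rcases i with _ | i
      · rw [hG0]; exact Submodule.zero_mem _
      · exact Finsupp.supported_mono (Set.image_mono (Set.Iic_subset_Iic.2 i.le_succ))
          (H i (by omega)).2.2.1
    have := hbest _ hmem
    rwa [map_add, Finsupp.linearCombination_single, ← sub_sub] at this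
  rcases eq_or_ne x 0 with hx0 | hx0
  · have h1 : r (i + 1) = 0 := by
      have := hstep 0
      rw [hx0, zero_smul, sub_zero, norm_zero] at this
      exact le_antisymm this (norm_nonneg _)
    have h2 : r i = 0 := by simp only [hr]; rw [← hx, hx0, norm_zero]
    rw [h1, h2, Real.zero_rpow (by linarith)]
    simp only [mul_zero, zero_div, sub_zero, zero_add]
    positivity
  -- The approximant is optimal also against its own multiples, so the norming functional of the
  -- residual annihilates it, and `F i f = ‖x‖`.
  have horth : F i (Finsupp.linearCombination ℂ g (G i)) = 0 := by
    rcases i with _ | i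
    · rw [hG0, map_zero, map_zero]
    obtain ⟨-, -, hmem, hmin⟩ := H i (by omega)
    refine norming_apply_eq_zero hq hX hx0 hF1 hFx fun z => ?_
    have := hmin (G (i + 1) + z • G (i + 1))
      (Submodule.add_mem _ hmem (Submodule.smul_mem _ _ hmem))
    rwa [map_add, map_smul, ← sub_sub] at this
  have hFf : (‖x‖ : ℂ) = ∑ k ∈ s, c k * F i (g k) := by
    rw [← hFx, hx, map_sub, horth, sub_zero, hf, map_sum]
    simp
  have hFg : ‖x‖ ≤ ‖F i (g (φ i))‖ * A := by
    have h1 : ‖x‖ = ‖∑ k ∈ s, c k * F i (g k)‖ := by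
      rw [← hFf, Complex.norm_real, norm_norm]
    rw [h1]
    refine (norm_sum_le _ _).trans ?_
    calc ∑ k ∈ s, ‖c k * F i (g k)‖ ≤ ∑ k ∈ s, ‖F i (g (φ i))‖ * ‖c k‖ :=
          Finset.sum_le_sum fun k hk => by
            rw [norm_mul, mul_comm]
            exact mul_le_mul_of_nonneg_right (by simpa using hmax k (hs hk)) (norm_nonneg _)
      _ = ‖F i (g (φ i))‖ * ∑ k ∈ s, ‖c k‖ := (Finset.mul_sum _ _ _).symm
      _ ≤ _ := mul_le_mul_of_nonneg_left hA (norm_nonneg _)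
  have hxpos := norm_pos_iff.2 hx0
  set w := F i (g (φ i)) with hw
  have hw0 : 0 < ‖w‖ := by
    by_contra hneg
    have : ‖w‖ = 0 := le_antisymm (not_lt.1 hneg) (norm_nonneg _)
    rw [this, zero_mul] at hFg
    linarith
  -- The phase of `z` makes `F i (z • g (φ i))` real and positive.
  set z : ℂ := (l : ℂ) * (starRingEnd ℂ w / (‖w‖ : ℂ)) with hz
  have hznorm : ‖z‖ = l := by
    rw [hz, norm_mul, norm_div, RCLike.norm_conj, Complex.norm_real, Complex.norm_real, norm_norm,
      div_self hw0.ne', mul_one, Real.norm_of_nonneg hl]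
  have hzre : (F i (z • g (φ i))).re = l * ‖w‖ := by
    have : z * w = ((l * ‖w‖ : ℝ) : ℂ) := by
      have hwc : (‖w‖ : ℂ) ≠ 0 := by exact_mod_cast hw0.ne'
      rw [hz, mul_assoc, div_mul_eq_mul_div, mul_comm (starRingEnd ℂ w), Complex.mul_conj,
        Complex.normSq_eq_norm_sq]
      push_cast
      field_simp
    rw [map_smul, smul_eq_mul, ← hw, this, Complex.ofReal_re]
  have h1 := norm_sub_rpow_le_of_norming hq hX hF1 hFx (z • g (φ i))
  have h2 : r (i + 1) ^ q ≤ ‖x - z • g (φ i)‖ ^ q :=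
    Real.rpow_le_rpow (norm_nonneg _) (hstep z) (by linarith)
  have h3 : ‖z • g (φ i)‖ ^ q ≤ l ^ q := by
    refine Real.rpow_le_rpow (norm_nonneg _) ?_ (by linarith)
    rw [norm_smul, hznorm]
    exact mul_le_of_le_one_right hl (hg _)
  rw [hzre] at h1
  have h4 : q * l * ‖x‖ ^ q / A ≤ q * ‖x‖ ^ (q - 1) * (l * ‖w‖) := by
    rw [div_le_iff₀ hA0]
    have e : ‖x‖ ^ q = ‖x‖ ^ (q - 1) * ‖x‖ := by
      rw [← Real.rpow_add_one hxpos.ne']; ring_nf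
    rw [e]
    have h5 : 0 ≤ q * l * ‖x‖ ^ (q - 1) := by positivity
    nlinarith [mul_le_mul_of_nonneg_left hFg h5]
  have h6 := mul_le_mul_of_nonneg_left h3 hK.le
  change r (i + 1) ^ q ≤ ‖x‖ ^ q - q * l * ‖x‖ ^ q / A + K * l ^ q
  linarith

end Greedy

/-! ### Combinatorics of dyadic blocks and hyperbolic layers -/

section Layers

variable {d : ℕ}

/-- Blocks and layers become level sets of binary lengths, which makes disjointness of layers
immediate. -/
theorem mem_dyadicBlock_iff {s : Fin d → ℕ} {k : Fin d → ℤ} :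
    k ∈ dyadicBlock s ↔ ∀ i, (k i).natAbs.size = s i := by
  simp only [dyadicBlock, Fintype.mem_piFinset, Finset.mem_filter, Finset.mem_Ioo]
  refine forall_congr' fun i => ?_
  generalize k i = x
  generalize s i = t
  have habs : |x| = (x.natAbs : ℤ) := Int.abs_eq_natAbs x
  rw [← abs_lt, habs]
  generalize x.natAbs = y
  rcases t with _ | t
  · rw [Nat.size_eq_zero]
    constructor
    · rintro ⟨h1, -⟩
      norm_num at h1
      omega
    · rintro rfl
      norm_num
  · have e : (2 : ℤ) ^ (t + 1) / 2 = 2 ^ t := by rw [pow_succ]; omega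
    have h1 : y.size ≤ t + 1 ↔ y < 2 ^ (t + 1) := Nat.size_le
    have h2 : t < y.size ↔ 2 ^ t ≤ y := Nat.lt_size
    rw [e]
    have c1 : ((y : ℤ) < 2 ^ (t + 1)) ↔ y < 2 ^ (t + 1) := by exact_mod_cast Iff.rfl
    have c2 : ((2 : ℤ) ^ t ≤ y) ↔ 2 ^ t ≤ y := by exact_mod_cast Iff.rfl
    rw [c1, c2, ← h1, ← h2]
    omega

theorem mem_hyperbolicLayer_iff {j : ℕ} {k : Fin d → ℤ} :
    k ∈ hyperbolicLayer d j ↔ ∑ i, (k i).natAbs.size = j := by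
  simp only [hyperbolicLayer, Finset.mem_biUnion, Finset.mem_piAntidiag, mem_dyadicBlock_iff]
  constructor
  · rintro ⟨s, ⟨hs, -⟩, h⟩
    rw [← hs]
    exact Finset.sum_congr rfl fun i _ => h i
  · intro h
    exact ⟨fun i => (k i).natAbs.size, ⟨h, fun _ _ => Finset.mem_univ _⟩, fun _ => rfl⟩

theorem disjoint_hyperbolicLayer {i j : ℕ} (h : i ≠ j) :
    Disjoint (hyperbolicLayer d i) (hyperbolicLayer d j) := by
  rw [Finset.disjoint_left]
  intro k hi hj
  rw [mem_hyperbolicLayer_iff] at hi hj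
  exact h (hi.symm.trans hj)

theorem hyperbolicLayer_nonempty (hd : 1 ≤ d) (j : ℕ) : (hyperbolicLayer d j).Nonempty := by
  -- The natural number `2 ^ j / 2` has binary length `j`, also for `j = 0`, where it is `0`.
  refine ⟨Function.update 0 ⟨0, hd⟩ ((2 ^ j / 2 : ℕ) : ℤ), ?_⟩
  rw [mem_hyperbolicLayer_iff, Finset.sum_eq_single ⟨0, hd⟩]
  · rw [Function.update_self, Int.natAbs_natCast]
    rcases j with _ | j
    · simp
    · rw [pow_succ, Nat.mul_div_cancel _ two_pos, Nat.size_pow]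
  · intro i _ hi
    simp [Function.update_of_ne hi]
  · simp

theorem card_dyadicBlock_le (s : Fin d → ℕ) : (dyadicBlock s).card ≤ 2 ^ ∑ i, s i := by
  rw [dyadicBlock, Fintype.card_piFinset, ← Finset.prod_pow_eq_pow_sum]
  refine Finset.prod_le_prod' fun i _ => ?_
  generalize s i = t
  rcases t with _ | t
  · refine (Finset.card_filter_le _ _).trans ?_
    simp
  · have e : (2 : ℤ) ^ (t + 1) / 2 = 2 ^ t := by rw [pow_succ]; omega
    have hsub : (Finset.Ioo (-(2 : ℤ) ^ (t + 1)) (2 ^ (t + 1))).filter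
        (fun k => (2 : ℤ) ^ (t + 1) / 2 ≤ |k|) ⊆
        Finset.Ioc (-(2 : ℤ) ^ (t + 1)) (-2 ^ t) ∪ Finset.Ico ((2 : ℤ) ^ t) (2 ^ (t + 1)) := by
      intro k
      simp only [Finset.mem_filter, Finset.mem_Ioo, Finset.mem_union, Finset.mem_Ioc,
        Finset.mem_Ico, e, le_abs]
      rintro ⟨⟨h1, h2⟩, h3 | h3⟩
      · exact Or.inr ⟨h3, h2⟩
      · exact Or.inl ⟨h1, by linarith⟩
    refine (Finset.card_le_card hsub).trans ((Finset.card_union_le _ _).trans ?_)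
    rw [Int.card_Ioc, Int.card_Ico]
    have e1 : (-2 ^ t - -(2 : ℤ) ^ (t + 1)) = ((2 ^ t : ℕ) : ℤ) := by push_cast; ring
    have e2 : ((2 : ℤ) ^ (t + 1) - 2 ^ t) = ((2 ^ t : ℕ) : ℤ) := by push_cast; ring
    rw [e1, e2, Int.toNat_natCast, pow_succ]
    omega

/-- The first coordinate is determined by the others and the sum, which saves one power of `j + 1`.
-/
theorem card_piAntidiag_univ_le (d j : ℕ) :
    (Finset.piAntidiag (Finset.univ : Finset (Fin (d + 1))) j).card ≤ (j + 1) ^ d := by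
  have hcard : (Fintype.piFinset fun _ : Fin d => Finset.range (j + 1)).card = (j + 1) ^ d := by
    rw [Fintype.card_piFinset_const, Finset.card_range]
  rw [← hcard]
  refine Finset.card_le_card_of_injOn Fin.tail (fun s hs => ?_) fun s hs s' hs' h => ?_
  · have hs := (Finset.mem_piAntidiag.1 hs).1
    refine Fintype.mem_piFinset.2 fun i => Finset.mem_range.2 (Nat.lt_succ_of_le ?_)
    rw [← hs]
    exact Finset.single_le_sum (f := s) (fun _ _ => Nat.zero_le _) (Finset.mem_univ i.succ)
  · have hs := (Finset.mem_piAntidiag.1 hs).1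
    have hs' := (Finset.mem_piAntidiag.1 hs').1
    rw [Fin.sum_univ_succ] at hs hs'
    have ht : ∀ i : Fin d, s i.succ = s' i.succ := fun i => congrFun h i
    simp only [ht] at hs
    funext i
    refine Fin.cases ?_ ht i
    omega

theorem card_hyperbolicLayer_le (hd : 1 ≤ d) (j : ℕ) :
    (hyperbolicLayer d j).card ≤ 2 ^ j * (j + 1) ^ (d - 1) := by
  obtain ⟨e, rfl⟩ : ∃ e, d = e + 1 := ⟨d - 1, by omega⟩
  refine (Finset.card_biUnion_le_card_mul _ _ (2 ^ j) fun s hs => ?_).trans ?_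
  · rw [← (Finset.mem_piAntidiag.1 hs).1]
    exact card_dyadicBlock_le s
  · rw [mul_comm]
    exact Nat.mul_le_mul_left _ (card_piAntidiag_univ_le e j)

theorem sum_card_hyperbolicLayer_le (hd : 1 ≤ d) (N : ℕ) :
    ∑ j ∈ Finset.range N, (hyperbolicLayer d j).card ≤ (2 ^ N - 1) * (N + 1) ^ (d - 1) := by
  have hgeom : ∑ j ∈ Finset.range N, 2 ^ j = 2 ^ N - 1 := by
    have := Nat.geomSum_eq (le_refl 2) N
    simpa using this
  rw [← hgeom, Finset.sum_mul]
  refine Finset.sum_le_sum fun j hj => (card_hyperbolicLayer_le hd j).trans ?_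
  have := Finset.mem_range.1 hj
  gcongr

/-- Enclosing the layers in a cube is crude, but a power of `2 ^ J` is all that the size of `Q`
requires. -/
theorem hyperbolicLayer_card_biUnion_le (d J : ℕ) :
    ((Finset.range J).biUnion (hyperbolicLayer d)).card ≤ 2 ^ ((J + 1) * d) := by
  have hsub : (Finset.range J).biUnion (hyperbolicLayer d) ⊆
      Fintype.piFinset fun _ : Fin d => Finset.Ico (-(2 : ℤ) ^ J) (2 ^ J) := by
    intro k hk
    obtain ⟨j, hj, hk⟩ := Finset.mem_biUnion.1 hk
    rw [mem_hyperbolicLayer_iff] at hk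
    refine Fintype.mem_piFinset.2 fun i => ?_
    have h1 : (k i).natAbs.size ≤ J := by
      refine le_trans ?_ (hk.trans_le (Finset.mem_range.1 hj).le)
      exact Finset.single_le_sum (f := fun i => (k i).natAbs.size) (fun _ _ => Nat.zero_le _)
        (Finset.mem_univ i)
    rw [Nat.size_le] at h1
    have h2 : |k i| < (2 : ℤ) ^ J := by
      rw [Int.abs_eq_natAbs]
      exact_mod_cast h1
    rw [abs_lt] at h2
    exact Finset.mem_Ico.2 ⟨h2.1.le, h2.2⟩
  refine (Finset.card_le_card hsub).trans ?_
  have e : ((2 : ℤ) ^ J - -2 ^ J) = ((2 ^ (J + 1) : ℕ) : ℤ) := by push_cast; ring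
  rw [Fintype.card_piFinset_const, Int.card_Ico, e, Int.toNat_natCast, ← pow_mul]

theorem exists_level (e : ℕ) {v : ℕ} (hv : 1 ≤ v) :
    ∃ N : ℕ, 2 * ((2 ^ N - 1) * (N + 1) ^ e) ≤ v ∧ 2 ^ N ≤ v ∧
      v < 2 * (2 ^ (N + 1) * (N + 2) ^ e) := by
  have hlow : ∀ N, 2 * ((2 ^ N - 1) * (N + 1) ^ e) ≤ v → 2 ^ N ≤ v := fun N hN => by
    rcases N with _ | N
    · simpa using hv
    · have h1 : 1 ≤ (N + 1 + 1) ^ e := Nat.one_le_pow _ _ (by omega)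
      have h2 : 2 ≤ 2 ^ (N + 1) := by rw [pow_succ]; have := Nat.one_le_two_pow (n := N); omega
      have h3 := Nat.mul_le_mul_left (2 ^ (N + 1) - 1) h1
      omega
  -- The level is the predecessor of the first failure. The `- 1` in `2 ^ N - 1` ensures that `N =
  -- 0` never fails.
  set P : ℕ → Prop := fun N => ¬ 2 * ((2 ^ N - 1) * (N + 1) ^ e) ≤ v with hP
  have hex : ∃ N, P N := ⟨v, fun h => absurd (hlow v h) (not_le.2 v.lt_two_pow_self)⟩
  classical
  obtain ⟨N, hN⟩ : ∃ N, Nat.find hex = N + 1 := by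
    refine ⟨Nat.find hex - 1, ?_⟩
    have : Nat.find hex ≠ 0 := fun h => by
      have := Nat.find_spec hex
      rw [h] at this
      simp [hP] at this
    omega
  have h1 : 2 * ((2 ^ N - 1) * (N + 1) ^ e) ≤ v := by
    have := Nat.find_min hex (m := N) (by omega)
    simpa only [hP, not_not] using this
  have h2 := Nat.find_spec hex
  rw [hN] at h2
  refine ⟨N, h1, hlow N h1, lt_of_lt_of_le (not_le.1 h2) ?_⟩
  exact Nat.mul_le_mul_left _ (Nat.mul_le_mul_right _ (Nat.sub_le _ _))

end Layers

/-! ### Selection of the largest coefficients -/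

section Selection

variable {ι : Type*}

theorem sum_norm_le_of_norm_le {β : ℝ} (hβ' : β ≤ 1) {s : Finset ι} {c : ι → ℂ} {T : ℝ}
    (hT : ∀ k ∈ s, ‖c k‖ ≤ T) : ∑ k ∈ s, ‖c k‖ ≤ T ^ (1 - β) * ∑ k ∈ s, ‖c k‖ ^ β := by
  rw [Finset.mul_sum]
  refine Finset.sum_le_sum fun k hk => ?_
  rcases (norm_nonneg (c k)).eq_or_lt with h0 | h0
  · rw [← h0]
    exact mul_nonneg (Real.rpow_nonneg (h0.trans_le (hT k hk)) _) (Real.rpow_nonneg le_rfl _)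
  · calc ‖c k‖ = ‖c k‖ ^ (1 - β) * ‖c k‖ ^ β := by
          rw [← Real.rpow_add h0]; simp
      _ ≤ _ := by
          exact mul_le_mul_of_nonneg_right
            (Real.rpow_le_rpow h0.le (hT k hk) (by linarith)) (by positivity)

theorem sum_norm_le_rpow {β : ℝ} (hβ : 0 < β) (hβ' : β ≤ 1) (s : Finset ι) (c : ι → ℂ) :
    ∑ k ∈ s, ‖c k‖ ≤ (∑ k ∈ s, ‖c k‖ ^ β) ^ (1 / β) := by
  set S := ∑ k ∈ s, ‖c k‖ ^ β with hS
  have hS0 : 0 ≤ S := Finset.sum_nonneg fun _ _ => by positivity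
  have hT : ∀ k ∈ s, ‖c k‖ ≤ S ^ (1 / β) := fun k hk => by
    have h1 : ‖c k‖ ^ β ≤ S :=
      Finset.single_le_sum (f := fun k => ‖c k‖ ^ β) (fun _ _ => by positivity) hk
    have h2 := Real.rpow_le_rpow (by positivity) h1 (show 0 ≤ 1 / β by positivity)
    rwa [← Real.rpow_mul (norm_nonneg _), mul_one_div_cancel hβ.ne', Real.rpow_one] at h2
  refine (sum_norm_le_of_norm_le hβ' hT).trans (le_of_eq ?_)
  rw [← hS]
  rcases hS0.eq_or_lt with h0 | h0
  · rw [← h0, mul_zero, Real.zero_rpow (by positivity)]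
  · rw [← Real.rpow_mul hS0, ← Real.rpow_add_one h0.ne']
    congr 1
    field_simp
    ring

/-- Stechkin's inequality: each unselected coefficient is dominated by `n` selected ones, hence is
at most `(S / n) ^ (1 / β)`. Splitting `‖c k‖ = ‖c k‖ ^ (1 - β) * ‖c k‖ ^ β` finishes. -/
theorem IsLargestSelection.sum_sdiff_le [DecidableEq ι] {β : ℝ} (hβ : 0 < β) (hβ' : β ≤ 1)
    {c : ι → ℂ} {Λ I : Finset ι} {n : ℕ} (hn : 0 < n) (H : IsLargestSelection c Λ n I) :
    ∑ k ∈ Λ \ I, ‖c k‖ ≤ (∑ k ∈ Λ, ‖c k‖ ^ β) ^ (1 / β) * (n : ℝ) ^ (1 - 1 / β) := by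
  obtain ⟨hI, hcard, hmax⟩ := H
  set S := ∑ k ∈ Λ, ‖c k‖ ^ β with hS
  have hS0 : 0 ≤ S := Finset.sum_nonneg fun _ _ => by positivity
  have hn' : (0 : ℝ) < n := by exact_mod_cast hn
  have hT : ∀ k ∈ Λ \ I, ‖c k‖ ≤ (S / n) ^ (1 / β) := fun k hk => by
    obtain ⟨hkΛ, hkI⟩ := Finset.mem_sdiff.1 hk
    have hIn : I.card = n := by
      rw [hcard, min_eq_left]
      by_contra hlt
      rw [min_eq_right (by omega)] at hcard
      exact hkI (Finset.eq_of_subset_of_card_le hI hcard.ge ▸ hkΛ)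
    have h1 : (n : ℝ) * ‖c k‖ ^ β ≤ S := by
      calc (n : ℝ) * ‖c k‖ ^ β = ∑ _l ∈ I, ‖c k‖ ^ β := by
            rw [Finset.sum_const, hIn, nsmul_eq_mul]
        _ ≤ ∑ l ∈ I, ‖c l‖ ^ β := Finset.sum_le_sum fun l hl =>
            Real.rpow_le_rpow (norm_nonneg _) (hmax l hl k hkΛ hkI) hβ.le
        _ ≤ S := Finset.sum_le_sum_of_subset_of_nonneg hI fun _ _ _ => by positivity
    have h2 : ‖c k‖ ^ β ≤ S / n := by rw [le_div_iff₀ hn']; linarith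
    have h3 := Real.rpow_le_rpow (by positivity) h2 (show 0 ≤ 1 / β by positivity)
    rwa [← Real.rpow_mul (norm_nonneg _), mul_one_div_cancel hβ.ne', Real.rpow_one] at h3
  have h4 : ∑ k ∈ Λ \ I, ‖c k‖ ^ β ≤ S :=
    Finset.sum_le_sum_of_subset_of_nonneg Finset.sdiff_subset fun _ _ _ => by positivity
  refine (sum_norm_le_of_norm_le hβ' hT).trans
    ((mul_le_mul_of_nonneg_left h4 (by positivity)).trans (le_of_eq ?_))
  rw [← Real.rpow_mul (by positivity), Real.div_rpow hS0 hn'.le]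
  have e : (1 : ℝ) - 1 / β = -(1 / β * (1 - β)) := by field_simp; ring
  rw [e, Real.rpow_neg hn'.le, div_mul_eq_mul_div, div_eq_mul_inv]
  congr 1
  rcases hS0.eq_or_lt with h0 | h0
  · rw [← h0, mul_zero, Real.zero_rpow (by positivity)]
  · rw [← Real.rpow_add_one h0.ne']
    congr 1
    field_simp
    ring

theorem exists_isLargestSelection (c : ι → ℂ) (Λ : Finset ι) (n : ℕ) :
    ∃ I, IsLargestSelection c Λ n I := by
  classical
  induction n with
  | zero => exact ⟨∅, by simp [IsLargestSelection]⟩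
  | succ n ih =>
    obtain ⟨I, hI, hcard, hmax⟩ := ih
    rcases (Λ \ I).eq_empty_or_nonempty with h | h
    · have : I = Λ := hI.antisymm (Finset.sdiff_eq_empty_iff_subset.1 h)
      subst this
      exact ⟨I, hI, by omega, fun k _ l hl hl' => absurd hl hl'⟩
    · obtain ⟨k, hk, hkmax⟩ := (Λ \ I).exists_max_image (fun k => ‖c k‖) h
      obtain ⟨hkΛ, hkI⟩ := Finset.mem_sdiff.1 hk
      have hlt : I.card < Λ.card := Finset.card_lt_card
        (Finset.ssubset_iff_subset_ne.2 ⟨hI, fun h' => hkI (h' ▸ hkΛ)⟩)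
      refine ⟨insert k I, Finset.insert_subset hkΛ hI, ?_, ?_⟩
      · rw [Finset.card_insert_of_notMem hkI]
        omega
      · intro i hi l hl hlI
        rw [Finset.mem_insert, not_or] at hlI
        rcases Finset.mem_insert.1 hi with rfl | hi
        · exact hkmax l (Finset.mem_sdiff.2 ⟨hl, hlI.2⟩)
        · exact hmax i hi l hl hlI.2

variable {X : Type*} [NormedAddCommGroup X] [NormedSpace ℂ X]

/-- The error of selecting `⌊w⌋₊` largest terms followed by `⌊w⌋₊` greedy iterations. -/
theorem IsLargestSelection.norm_sub_le [DecidableEq ι] {q K β w : ℝ} (hq : 1 < q) (hq2 : q ≤ 2)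
    (hK : 0 < K) (hX : ∀ x y : X, ‖x + y‖ ^ q + ‖x - y‖ ^ q ≤ 2 * ‖x‖ ^ q + K * ‖y‖ ^ q)
    (hβ : 0 < β) (hβ' : β ≤ 1) (hw : 0 < w)
    {g : ι → X} (hg : ∀ k, ‖g k‖ ≤ 1) {c : ι → ℂ} {Λ I : Finset ι}
    (H : IsLargestSelection c Λ ⌊w⌋₊ I) {h : ι →₀ ℂ}
    (hh : IsWCGAOutput 1 g Λ (∑ k ∈ Λ \ I, c k • g k) ⌊w⌋₊ h) :
    ‖(∑ k ∈ Λ \ I, c k • g k) - Finsupp.linearCombination ℂ g h‖ ≤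
      (1 + (K * (q - 1) ^ (1 - q)) ^ (1 / q) * 2 ^ (1 / β - 1 / q)) * w ^ (1 / q - 1 / β) *
        (∑ k ∈ Λ, ‖c k‖ ^ β) ^ (1 / β) := by
  have hq1 : 0 < q - 1 := by linarith
  set M := (∑ k ∈ Λ, ‖c k‖ ^ β) ^ (1 / β) with hM
  have hM0 : 0 ≤ M := Real.rpow_nonneg (Finset.sum_nonneg fun _ _ => by positivity) _
  set C := (K * (q - 1) ^ (1 - q)) ^ (1 / q) with hC
  have hC0 : 0 < C := by positivity
  have hexp : 1 / q - 1 / β ≤ 0 := by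
    have h1 : 1 / q ≤ 1 := by rw [div_le_one (by linarith)]; linarith
    have h2 : 1 ≤ 1 / β := by rw [le_div_iff₀ hβ]; linarith
    linarith
  have hwp : 0 < w ^ (1 / q - 1 / β) := by positivity
  -- For `w < 1` nothing need be approximated: the negative power of `w` is at least `1`, and the
  -- norm of the remaining terms is at most their `ℓ_β` quasinorm.
  rcases Nat.eq_zero_or_pos ⌊w⌋₊ with h0 | h0
  · have hh0 : h = 0 := by
      have := hh.support_subset.2
      rw [h0, Nat.le_zero, Finset.card_eq_zero, Finsupp.support_eq_empty] at this
      exact this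
    have hw1 : 1 ≤ w ^ (1 / q - 1 / β) :=
      Real.one_le_rpow_of_pos_of_le_one_of_nonpos hw (Nat.floor_eq_zero.1 h0).le hexp
    have h1 : ‖∑ k ∈ Λ \ I, c k • g k‖ ≤ M := by
      refine (norm_sum_le _ _).trans (le_trans ?_ (sum_norm_le_rpow hβ hβ' Λ c))
      refine (Finset.sum_le_sum_of_subset_of_nonneg Finset.sdiff_subset
        fun _ _ _ => norm_nonneg _).trans (Finset.sum_le_sum fun k _ => ?_)
      rw [norm_smul]
      exact mul_le_of_le_one_right (norm_nonneg _) (hg k)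
    rw [hh0, map_zero, sub_zero]
    have h2 : 0 < C * 2 ^ (1 / β - 1 / q) := by positivity
    have h3 : 1 ≤ (1 + C * 2 ^ (1 / β - 1 / q)) * w ^ (1 / q - 1 / β) := by nlinarith
    exact h1.trans (le_mul_of_one_le_left hM0 h3)
  · have h1 := hh.norm_sub_le hq hq2 hK hX hg Finset.sdiff_subset c
      (H.sum_sdiff_le hβ hβ' h0) h0
    refine h1.trans ?_
    set n := ⌊w⌋₊ with hn
    have hn' : (0 : ℝ) < n := by exact_mod_cast h0
    have hn1 : (1 : ℝ) ≤ n := by exact_mod_cast h0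
    have h2 : (n : ℝ) ^ (1 / q - 1 / β) ≤ 2 ^ (1 / β - 1 / q) * w ^ (1 / q - 1 / β) := by
      have h3 : w / 2 ≤ n := by have := Nat.lt_floor_add_one w; rw [← hn] at this; linarith
      refine (Real.rpow_le_rpow_of_nonpos (by positivity) h3 hexp).trans (le_of_eq ?_)
      rw [Real.div_rpow hw.le zero_le_two, div_eq_mul_inv, ← Real.rpow_neg zero_le_two]
      ring_nf
    have h4 : C * (M * (n : ℝ) ^ (1 - 1 / β)) * (n : ℝ) ^ (1 / q - 1) =
        C * (n : ℝ) ^ (1 / q - 1 / β) * M := by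
      have : (n : ℝ) ^ (1 / q - 1 / β) = (n : ℝ) ^ (1 - 1 / β) * (n : ℝ) ^ (1 / q - 1) := by
        rw [← Real.rpow_add hn']; ring_nf
      rw [this]; ring
    rw [hM, h4]
    refine mul_le_mul_of_nonneg_right ?_ hM0
    nlinarith [mul_le_mul_of_nonneg_left h2 hC0.le]

end Selection

/-! ### The hyperbolic scheme: outputs, size and error -/

/-- The scheme whose blocks are the first `J` hyperbolic layers. The layers below `N` are kept
completely; in the layer `j ≥ N` there are `⌊w j⌋₊` selections and `⌊w j⌋₊` iterations. -/
noncomputable def hyperbolicScheme (d N J : ℕ) (w : ℕ → ℝ) : GreedyScheme (Fin d → ℤ) where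
  num := J
  block j := hyperbolicLayer d j
  disjoint _ _ h := disjoint_hyperbolicLayer (Fin.val_ne_of_ne h)
  select j := if (j : ℕ) < N then (hyperbolicLayer d j).card else ⌊w j⌋₊
  iterate j := if (j : ℕ) < N then 0 else ⌊w j⌋₊

theorem isProbabilityMeasure_measureXi {Ω : Type*} [MeasurableSpace Ω] (μ : Measure Ω)
    [IsProbabilityMeasure μ] {m : ℕ} (hm : 0 < m) (ξ : Fin m → Ω) :
    IsProbabilityMeasure (measureXi μ ξ) := by
  refine ⟨?_⟩
  have hm' : (m : ℝ≥0∞) ≠ 0 := by exact_mod_cast hm.ne'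
  simp only [measureXi, Measure.smul_apply, Measure.add_apply, Measure.finsetSum_apply,
    smul_eq_mul, measure_univ, Finset.sum_const, Finset.card_univ, Fintype.card_fin, nsmul_eq_mul,
    mul_one]
  rw [ENNReal.inv_mul_cancel hm' (ENNReal.natCast_ne_top m), one_add_one_eq_two,
    ENNReal.inv_mul_cancel two_ne_zero ENNReal.ofNat_ne_top]

theorem nontrivial_Lp {Ω : Type*} [MeasurableSpace Ω] {p : ℝ≥0∞} [Fact (1 ≤ p)]
    {ν : Measure Ω} [IsProbabilityMeasure ν] : Nontrivial (Lp ℂ p ν) := by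
  have h1 : (1 : ℝ≥0∞) ≤ p := Fact.out
  refine ⟨⟨Lp.const p ν (1 : ℂ), 0, fun h => ?_⟩⟩
  have := Lp.norm_const p ν (1 : ℂ) (zero_lt_one.trans_le h1).ne'
  rw [h] at this
  simp at this

theorem linearCombination_indicator {ι X : Type*} [AddCommGroup X] [Module ℂ X] (s : Finset ι)
    (ψ : ι → X) (c : ι → ℂ) :
    Finsupp.linearCombination ℂ ψ (Finsupp.indicator s (fun k _ => c k)) =
      ∑ k ∈ s, c k • ψ k := by
  rw [Finsupp.linearCombination_apply, Finsupp.sum_of_support_subset _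
    (Finsupp.support_indicator_subset _ _) _ (by simp)]
  refine Finset.sum_congr rfl fun k hk => ?_
  rw [Finsupp.indicator_of_mem hk]

section Output

variable {ι Ω : Type*} [DecidableEq ι] [TopologicalSpace Ω] [CompactSpace Ω]
    [MeasurableSpace Ω] [BorelSpace Ω] {p : ℝ≥0∞} [Fact (1 ≤ p)]
    {ν : Measure Ω}

theorem norm_toLp_le [IsProbabilityMeasure ν] (f : C(Ω, ℂ)) :
    ‖ContinuousMap.toLp p ν ℂ f‖ ≤ ‖f‖ := by
  have h := ContinuousMap.toLp_norm_le (p := p) (E := ℂ) ν (𝕜 := ℂ)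
  have h1 : measureUnivNNReal ν = 1 := by simp [measureUnivNNReal]
  rw [h1, NNReal.coe_one, Real.one_rpow] at h
  exact (ContinuousLinearMap.le_of_opNorm_le _ h f).trans (one_mul _).le

theorem GreedyScheme.exists_isOutput [IsProbabilityMeasure ν] (S : GreedyScheme ι)
    (hS : ∀ j, (S.block j).Nonempty) (ψ : ι → C(Ω, ℂ)) (c : ι → ℂ) :
    ∃ h, S.IsOutput p ν ψ c h := by
  have := nontrivial_Lp (p := p) (ν := ν)
  choose I hI using fun j => exists_isLargestSelection c (S.block j) (S.select j)
  choose G hG using fun j => exists_isWCGAOutput (fun k => ContinuousMap.toLp p ν ℂ (ψ k)) (hS j)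
    (ContinuousMap.toLp p ν ℂ (∑ k ∈ S.block j \ I j, c k • ψ k)) (S.iterate j)
  exact ⟨_, I, G, fun j => ⟨hI j, hG j⟩, rfl⟩

theorem GreedyScheme.IsOutput.support_subset [IsFiniteMeasure ν] {S : GreedyScheme ι}
    {ψ : ι → C(Ω, ℂ)} {c : ι → ℂ} {h : ι →₀ ℂ} (H : S.IsOutput p ν ψ c h) :
    h.support ⊆ Finset.univ.biUnion S.block ∧
      h.support.card ≤ ∑ j, (S.select j + S.iterate j) := by
  obtain ⟨I, G, H, rfl⟩ := H
  have hsub : (∑ j, (Finsupp.indicator (I j) (fun k _ => c k) + G j)).support ⊆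
      Finset.univ.biUnion fun j => I j ∪ (G j).support := by
    refine Finsupp.support_finsetSum.trans (Finset.biUnion_mono fun j _ => ?_)
    exact Finsupp.support_add.trans
      (Finset.union_subset_union (Finsupp.support_indicator_subset _ _) le_rfl)
  constructor
  · refine hsub.trans (Finset.biUnion_mono fun j _ => ?_)
    exact Finset.union_subset (H j).1.1 (H j).2.support_subset.1
  · refine (Finset.card_le_card hsub).trans (Finset.card_biUnion_le.trans
      (Finset.sum_le_sum fun j _ => (Finset.card_union_le _ _).trans ?_))
    refine add_le_add ?_ (H j).2.support_subset.2
    rw [(H j).1.2.1]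
    exact min_le_left _ _

end Output

section Hyperbolic

variable {d N J : ℕ} {w : ℕ → ℝ}

theorem hyperbolicScheme_support {Ω : Type*} [TopologicalSpace Ω] [CompactSpace Ω]
    [MeasurableSpace Ω] [BorelSpace Ω] {p : ℝ≥0∞} [Fact (1 ≤ p)] {ν : Measure Ω}
    [IsFiniteMeasure ν] (hNJ : N ≤ J) {ψ : (Fin d → ℤ) → C(Ω, ℂ)} {c : (Fin d → ℤ) → ℂ}
    {h : (Fin d → ℤ) →₀ ℂ} (H : (hyperbolicScheme d N J w).IsOutput p ν ψ c h) :
    h.support ⊆ (Finset.range J).biUnion (hyperbolicLayer d) ∧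
      h.support.card ≤ ∑ j ∈ Finset.range N, (hyperbolicLayer d j).card +
        ∑ j ∈ Finset.Ico N J, 2 * ⌊w j⌋₊ := by
  obtain ⟨h1, h2⟩ := H.support_subset
  constructor
  · refine h1.trans fun k hk => ?_
    obtain ⟨j, -, hj⟩ := Finset.mem_biUnion.1 hk
    exact Finset.mem_biUnion.2 ⟨j, Finset.mem_range.2 j.2, hj⟩
  · refine h2.trans (le_of_eq ?_)
    have e := Fin.sum_univ_eq_sum_range (fun j => (if j < N then (hyperbolicLayer d j).card
      else ⌊w j⌋₊) + (if j < N then 0 else ⌊w j⌋₊)) J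
    refine e.trans ?_
    rw [← Finset.sum_range_add_sum_Ico _ hNJ]
    congr 1
    · refine Finset.sum_congr rfl fun j hj => ?_
      rw [if_pos (Finset.mem_range.1 hj), if_pos (Finset.mem_range.1 hj), add_zero]
    · refine Finset.sum_congr rfl fun j hj => ?_
      have := (Finset.mem_Ico.1 hj).1
      rw [if_neg (by omega), if_neg (by omega), two_mul]

/-- The layers below `N` are reproduced exactly, those in `[N, J)` obey the one-block bound, and the
later ones are discarded. Because `w j ≤ 1` from `J` on, the discarded layers satisfy the same bound
`E j`, so a single sum controls everything. -/
theorem hyperbolicScheme_error {Ω : Type*} [TopologicalSpace Ω] [CompactSpace Ω]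
    [MeasurableSpace Ω] [BorelSpace Ω] {p : ℝ≥0∞} [Fact (1 ≤ p)] {ν : Measure Ω}
    [IsProbabilityMeasure ν] {q K β : ℝ} (hq : 1 < q) (hq2 : q ≤ 2) (hK : 0 < K)
    (hX : ∀ x y : Lp ℂ p ν, ‖x + y‖ ^ q + ‖x - y‖ ^ q ≤ 2 * ‖x‖ ^ q + K * ‖y‖ ^ q)
    (hβ : 0 < β) (hβ' : β ≤ 1) (hNJ : N ≤ J) (hw : ∀ j, 0 < w j) (hwJ : ∀ j ≥ J, w j ≤ 1)
    {ψ : (Fin d → ℤ) → C(Ω, ℂ)} (hψ : ∀ k x, ‖ψ k x‖ ≤ 1) {f : C(Ω, ℂ)} {c : (Fin d → ℤ) → ℂ}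
    (hf : HasSum (fun k => c k • ψ k) f) {M : ℕ → ℝ}
    (hM : ∀ j, (∑ k ∈ hyperbolicLayer d j, ‖c k‖ ^ β) ^ (1 / β) ≤ M j) {B : ℝ}
    (hB : ∀ J', ∑ j ∈ Finset.Ico N J', (1 + (K * (q - 1) ^ (1 - q)) ^ (1 / q) *
      2 ^ (1 / β - 1 / q)) * w j ^ (1 / q - 1 / β) * M j ≤ B)
    {h : (Fin d → ℤ) →₀ ℂ} (H : (hyperbolicScheme d N J w).IsOutput p ν ψ c h) :
    ‖ContinuousMap.toLp p ν ℂ (f - Finsupp.linearCombination ℂ ψ h)‖ ≤ B := by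
  have hq1 : 0 < q - 1 := by linarith
  set C := 1 + (K * (q - 1) ^ (1 - q)) ^ (1 / q) * 2 ^ (1 / β - 1 / q) with hC
  have hC1 : 1 ≤ C := by
    rw [hC]
    have : 0 ≤ (K * (q - 1) ^ (1 - q)) ^ (1 / q) * 2 ^ (1 / β - 1 / q) := by positivity
    linarith
  set E : ℕ → ℝ := fun j => C * w j ^ (1 / q - 1 / β) * M j with hE
  set L := ContinuousMap.toLp (E := ℂ) p ν ℂ with hL
  have hψ1 : ∀ k, ‖ψ k‖ ≤ 1 := fun k => (ContinuousMap.norm_le _ zero_le_one).2 (hψ k)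
  have hg : ∀ k, ‖L (ψ k)‖ ≤ 1 := fun k => (norm_toLp_le (ψ k)).trans (hψ1 k)
  have hM0 : ∀ j, 0 ≤ M j := fun j => le_trans
    (Real.rpow_nonneg (Finset.sum_nonneg fun _ _ => by positivity) _) (hM j)
  have hexp : 1 / q - 1 / β ≤ 0 := by
    have h1 : 1 / q ≤ 1 := by rw [div_le_one (by linarith)]; linarith
    have h2 : 1 ≤ 1 / β := by rw [le_div_iff₀ hβ]; linarith
    linarith
  obtain ⟨I, G, H, rfl⟩ : ∃ (I : Fin J → Finset (Fin d → ℤ)) (G : Fin J → (Fin d → ℤ) →₀ ℂ),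
      (∀ j : Fin J, IsLargestSelection c (hyperbolicLayer d j)
          (if (j : ℕ) < N then (hyperbolicLayer d j).card else ⌊w j⌋₊) (I j) ∧
        IsWCGAOutput 1 (fun k => L (ψ k)) (hyperbolicLayer d j)
          (L (∑ k ∈ hyperbolicLayer d j \ I j, c k • ψ k))
          (if (j : ℕ) < N then 0 else ⌊w j⌋₊) (G j)) ∧
      h = ∑ j, (Finsupp.indicator (I j) (fun k _ => c k) + G j) := H
  set Q := (Finset.range J).biUnion (hyperbolicLayer d) with hQ
  set Λ : Fin J → Finset (Fin d → ℤ) := fun j => hyperbolicLayer d j with hΛ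
  have hblock : ∀ j : Fin J, ‖L (∑ k ∈ Λ j \ I j, c k • ψ k - Finsupp.linearCombination ℂ ψ (G j))‖
      ≤ if (j : ℕ) < N then 0 else E j := by
    intro j
    obtain ⟨hsel, hout⟩ := H j
    have hLlc : ∀ g : (Fin d → ℤ) →₀ ℂ, L (Finsupp.linearCombination ℂ ψ g) =
        Finsupp.linearCombination ℂ (fun k => L (ψ k)) g := fun g => by
      rw [Finsupp.linearCombination_apply, Finsupp.linearCombination_apply, Finsupp.sum,
        Finsupp.sum, map_sum]
      simp only [map_smul]
    split_ifs at hsel hout ⊢ with hjN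
    · have hG : G j = 0 := by
        have := hout.support_subset.2
        rwa [Nat.le_zero, Finset.card_eq_zero, Finsupp.support_eq_empty] at this
      have hI : I j = Λ j := Finset.eq_of_subset_of_card_le hsel.1 (by
        rw [hsel.2.1, min_self])
      rw [hG, hI, Finset.sdiff_self, Finset.sum_empty, map_zero, sub_zero, map_zero, norm_zero]
    · have hsum : L (∑ k ∈ Λ j \ I j, c k • ψ k) = ∑ k ∈ Λ j \ I j, c k • L (ψ k) := by
        rw [map_sum]
        simp only [map_smul]
      rw [hsum] at hout
      rw [map_sub, hLlc, hsum]
      refine (hsel.norm_sub_le hq hq2 hK hX hβ hβ' (hw j) hg hout).trans ?_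
      have : 0 < w j := hw j
      exact mul_le_mul_of_nonneg_left (hM j) (by positivity)
  -- The estimate is proved for finite partial sums containing `Q` and passes to `f` by continuity
  -- of the embedding into `L_p`.
  have hfinite : ∀ T : Finset (Fin d → ℤ), Q ⊆ T →
      ‖L (∑ k ∈ T, c k • ψ k - Finsupp.linearCombination ℂ ψ
        (∑ j, (Finsupp.indicator (I j) (fun k _ => c k) + G j)))‖ ≤ B := by
    intro T hT
    have hQsum : ∑ k ∈ Q, c k • ψ k = ∑ j : Fin J, ∑ k ∈ Λ j, c k • ψ k := by
      rw [hQ, Finset.sum_biUnion fun i _ j _ hij => disjoint_hyperbolicLayer hij]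
      exact (Fin.sum_univ_eq_sum_range (fun j => ∑ k ∈ hyperbolicLayer d j, c k • ψ k) J).symm
    have hdecomp : ∑ k ∈ T, c k • ψ k - Finsupp.linearCombination ℂ ψ
        (∑ j, (Finsupp.indicator (I j) (fun k _ => c k) + G j)) =
        (∑ j, (∑ k ∈ Λ j \ I j, c k • ψ k - Finsupp.linearCombination ℂ ψ (G j))) +
          ∑ k ∈ T \ Q, c k • ψ k := by
      rw [← Finset.sum_sdiff hT, hQsum, map_sum, add_comm, add_sub_right_comm,
        add_left_inj]
      rw [← Finset.sum_sub_distrib]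
      refine Finset.sum_congr rfl fun j _ => ?_
      have hsub : I j ⊆ Λ j := (H j).1.1
      rw [map_add, linearCombination_indicator, ← Finset.sum_sdiff hsub]
      abel
    obtain ⟨J', hJJ', hJ'⟩ : ∃ J' ≥ J, ∀ k ∈ T, ∑ i, (k i).natAbs.size < J' := by
      refine ⟨J + (T.sup fun k => ∑ i, (k i).natAbs.size) + 1, by omega, fun k hk => ?_⟩
      have := Finset.le_sup (f := fun k : Fin d → ℤ => ∑ i, (k i).natAbs.size) hk
      omega
    have hhead : ‖L (∑ j, (∑ k ∈ Λ j \ I j, c k • ψ k - Finsupp.linearCombination ℂ ψ (G j)))‖ ≤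
        ∑ j ∈ Finset.Ico N J, E j := by
      rw [map_sum]
      refine (norm_sum_le _ _).trans ((Finset.sum_le_sum fun j _ => hblock j).trans (le_of_eq ?_))
      have e := Fin.sum_univ_eq_sum_range (fun j => if j < N then 0 else E j) J
      refine e.trans ?_
      rw [← Finset.sum_range_add_sum_Ico _ hNJ, Finset.sum_eq_zero, zero_add]
      · refine Finset.sum_congr rfl fun j hj => ?_
        rw [if_neg (by have := (Finset.mem_Ico.1 hj).1; omega)]
      · intro j hj
        rw [if_pos (Finset.mem_range.1 hj)]
    have htail : ‖L (∑ k ∈ T \ Q, c k • ψ k)‖ ≤ ∑ j ∈ Finset.Ico J J', E j := by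
      refine (norm_toLp_le _).trans ((norm_sum_le _ _).trans ?_)
      have hsub : T \ Q ⊆ (Finset.Ico J J').biUnion (hyperbolicLayer d) := fun k hk => by
        obtain ⟨hkT, hkQ⟩ := Finset.mem_sdiff.1 hk
        refine Finset.mem_biUnion.2 ⟨_, Finset.mem_Ico.2 ⟨?_, hJ' k hkT⟩,
          mem_hyperbolicLayer_iff.2 rfl⟩
        by_contra hlt
        exact hkQ (Finset.mem_biUnion.2 ⟨_, Finset.mem_range.2 (not_le.1 hlt),
          mem_hyperbolicLayer_iff.2 rfl⟩)
      calc ∑ k ∈ T \ Q, ‖c k • ψ k‖ ≤ ∑ k ∈ T \ Q, ‖c k‖ := Finset.sum_le_sum fun k _ => by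
            rw [norm_smul]
            exact mul_le_of_le_one_right (norm_nonneg _) (hψ1 k)
        _ ≤ ∑ k ∈ (Finset.Ico J J').biUnion (hyperbolicLayer d), ‖c k‖ :=
            Finset.sum_le_sum_of_subset_of_nonneg hsub fun _ _ _ => norm_nonneg _
        _ = ∑ j ∈ Finset.Ico J J', ∑ k ∈ hyperbolicLayer d j, ‖c k‖ :=
            Finset.sum_biUnion fun i _ j _ hij => disjoint_hyperbolicLayer hij
        _ ≤ ∑ j ∈ Finset.Ico J J', E j := Finset.sum_le_sum fun j hj => by
            refine (sum_norm_le_rpow hβ hβ' _ c).trans ((hM j).trans ?_)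
            have h1 : 1 ≤ w j ^ (1 / q - 1 / β) :=
              Real.one_le_rpow_of_pos_of_le_one_of_nonpos (hw j)
                (hwJ j (Finset.mem_Ico.1 hj).1) hexp
            exact le_mul_of_one_le_left (hM0 j) (one_le_mul_of_one_le_of_one_le hC1 h1)
    rw [hdecomp, map_add]
    refine (norm_add_le _ _).trans ((add_le_add hhead htail).trans ?_)
    rw [Finset.sum_Ico_consecutive _ hNJ hJJ']
    exact hB J'
  have hlim : Filter.Tendsto (fun T : Finset (Fin d → ℤ) =>
      ‖L (∑ k ∈ T, c k • ψ k - Finsupp.linearCombination ℂ ψ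
        (∑ j, (Finsupp.indicator (I j) (fun k _ => c k) + G j)))‖) Filter.atTop
      (nhds ‖L (f - Finsupp.linearCombination ℂ ψ
        (∑ j, (Finsupp.indicator (I j) (fun k _ => c k) + G j)))‖) :=
    ((L.continuous.tendsto _).comp (Filter.Tendsto.sub_const hf _)).norm
  exact le_of_tendsto hlim (Filter.eventually_atTop.2 ⟨Q, hfinite⟩)

end Hyperbolic

/-! ### Summation over layers and choice of the level -/

/-- Comparability up to a factor `t` passes to powers of either sign, as is needed because `b` may
be negative. -/
theorem rpow_le_mul_rpow_abs {x y t : ℝ} (hx : 0 < x) (hy : 0 < y) (ht : 1 ≤ t)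
    (hxy : x ≤ y * t) (hyx : y ≤ x * t) (e : ℝ) : x ^ e ≤ y ^ e * t ^ |e| := by
  rcases le_total 0 e with he | he
  · rw [abs_of_nonneg he, ← Real.mul_rpow hy.le (by linarith)]
    exact Real.rpow_le_rpow hx.le hxy he
  · rw [abs_of_nonpos he, Real.rpow_neg (by linarith), ← div_eq_mul_inv,
      ← Real.div_rpow hy.le (by linarith)]
    refine Real.rpow_le_rpow_of_nonpos (by positivity) ?_ he
    rwa [div_le_iff₀ (by linarith)]

theorem summable_rpow_mul_geometric {r : ℝ} (hr : 0 < r) (hr1 : r < 1) (s : ℝ) :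
    Summable fun l : ℕ => r ^ l * (2 * ((l : ℝ) + 1)) ^ s := by
  set k := ⌈s⌉₊ with hk
  have h0 : Summable fun l : ℕ => (l : ℝ) ^ k * r ^ l :=
    summable_pow_mul_geometric_of_norm_lt_one k (by rwa [Real.norm_of_nonneg hr.le])
  have h1 : Summable fun l : ℕ => ((l + 1 : ℕ) : ℝ) ^ k * r ^ (l + 1) :=
    (summable_nat_add_iff (f := fun l : ℕ => (l : ℝ) ^ k * r ^ l) 1).2 h0
  refine Summable.of_nonneg_of_le (fun l => by positivity) (fun l => ?_) (h1.mul_left (2 ^ k / r))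
  have h2 : (2 * ((l : ℝ) + 1)) ^ s ≤ (2 * ((l : ℝ) + 1)) ^ k := by
    rw [← Real.rpow_natCast]
    have hl : (0 : ℝ) ≤ l := l.cast_nonneg
    exact Real.rpow_le_rpow_of_exponent_le (by linarith) (Nat.le_ceil s)
  refine (mul_le_mul_of_nonneg_left h2 (by positivity)).trans (le_of_eq ?_)
  push_cast
  rw [mul_pow, pow_succ]
  field_simp

theorem max_rpow_le (e : ℝ) (N l : ℕ) :
    max ((N + l : ℕ) : ℝ) 1 ^ e ≤ ((N : ℝ) + 1) ^ e * (2 * ((l : ℝ) + 1)) ^ |e| := by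
  have hN : (0 : ℝ) ≤ N := N.cast_nonneg
  have hl : (0 : ℝ) ≤ l := l.cast_nonneg
  have h1 : (1 : ℝ) ≤ max ((N + l : ℕ) : ℝ) 1 := le_max_right _ _
  have h2 : (N : ℝ) + l ≤ max ((N + l : ℕ) : ℝ) 1 := by
    refine le_trans (le_of_eq ?_) (le_max_left _ _)
    push_cast
    ring
  refine rpow_le_mul_rpow_abs (by linarith) (by linarith) (by linarith) ?_ ?_ e
  · refine max_le ?_ ?_
    · push_cast; nlinarith
    · nlinarith
  · nlinarith

/-- The sum of the layer errors `w_j ^ (-θ) 2 ^ (-a j) max(j,1) ^ e` for weights decaying like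
`2 ^ (-κ (j - N))` with `κ θ = a / 2`. -/
theorem exists_sum_layer_le {a θ κ : ℝ} (ha : 0 < a) (hκθ : κ * θ = a / 2) (e : ℝ) :
    ∃ S : ℝ, 0 < S ∧ ∀ (N J' : ℕ) (u : ℝ), 0 < u →
      ∑ j ∈ Finset.Ico N J', (u * (2 : ℝ) ^ (-κ * ((j : ℝ) - N))) ^ (-θ) *
        ((2 : ℝ) ^ (-a * (j : ℝ)) * (max (j : ℝ) 1) ^ e) ≤
      S * (u ^ (-θ) * (2 : ℝ) ^ (-a * (N : ℝ)) * ((N : ℝ) + 1) ^ e) := by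
  set r : ℝ := 2 ^ (-(a / 2)) with hr
  have hr0 : 0 < r := by positivity
  have hr1 : r < 1 := Real.rpow_lt_one_of_one_lt_of_neg one_lt_two (by linarith)
  have hsum := summable_rpow_mul_geometric hr0 hr1 |e|
  refine ⟨∑' l : ℕ, r ^ l * (2 * ((l : ℝ) + 1)) ^ |e|,
    hsum.tsum_pos (fun l => by positivity) 0 (by positivity), fun N J' u hu => ?_⟩
  rw [Finset.sum_Ico_eq_sum_range]
  have hterm : ∀ l : ℕ, (u * (2 : ℝ) ^ (-κ * (((N + l : ℕ) : ℝ) - N))) ^ (-θ) *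
        ((2 : ℝ) ^ (-a * ((N + l : ℕ) : ℝ)) * (max ((N + l : ℕ) : ℝ) 1) ^ e) ≤
      r ^ l * (2 * ((l : ℝ) + 1)) ^ |e| *
        (u ^ (-θ) * (2 : ℝ) ^ (-a * (N : ℝ)) * ((N : ℝ) + 1) ^ e) := fun l => by
    -- The decaying weights cost `2 ^ (κ * θ * l) = 2 ^ (a * l / 2)`, half of the available decay;
    -- the other half is `r ^ l`.
    have e1 : (u * (2 : ℝ) ^ (-κ * (((N + l : ℕ) : ℝ) - N))) ^ (-θ) *
        (2 : ℝ) ^ (-a * ((N + l : ℕ) : ℝ)) = u ^ (-θ) * (2 : ℝ) ^ (-a * (N : ℝ)) * r ^ l := by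
      rw [Real.mul_rpow hu.le (by positivity), ← Real.rpow_mul zero_le_two,
        mul_assoc (u ^ (-θ)), ← Real.rpow_add zero_lt_two, mul_assoc (u ^ (-θ)), hr, ← Real.rpow_mul_natCast zero_le_two,
        ← Real.rpow_add zero_lt_two]
      congr 2
      push_cast
      have : -κ * ((N : ℝ) + l - N) * -θ = κ * θ * l := by ring
      rw [this, hκθ]
      ring
    rw [← mul_assoc, e1]
    refine (mul_le_mul_of_nonneg_left (max_rpow_le e N l) (by positivity)).trans (le_of_eq ?_)
    ring
  refine (Finset.sum_le_sum fun l _ => hterm l).trans ?_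
  rw [← Finset.sum_mul]
  exact mul_le_mul_of_nonneg_right (hsum.sum_le_tsum _ fun l _ => by positivity) (by positivity)

/-- The factor `(1 - 2 ^ (-κ)) / 4` normalizes the geometric series: doubled for selections plus
iterations, it sums to at most `v / 2`. -/
theorem sum_floor_weights_le {κ : ℝ} (hκ : 0 < κ) (N J v : ℕ) :
    ((∑ j ∈ Finset.Ico N J,
      2 * ⌊((1 - (2 : ℝ) ^ (-κ)) / 4 * v) * (2 : ℝ) ^ (-κ * ((j : ℝ) - N))⌋₊ : ℕ) : ℝ) ≤
        (v : ℝ) / 2 := by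
  set r : ℝ := 2 ^ (-κ) with hr
  have hr0 : 0 < r := by positivity
  have hr1 : r < 1 := Real.rpow_lt_one_of_one_lt_of_neg one_lt_two (by linarith)
  have hv : (0 : ℝ) ≤ v := v.cast_nonneg
  set u := (1 - r) / 4 * v with hu
  have hu0 : 0 ≤ u := mul_nonneg (by linarith) hv
  rw [Finset.sum_Ico_eq_sum_range]
  push_cast
  have hterm : ∀ l : ℕ, (2 : ℝ) * (⌊u * (2 : ℝ) ^ (-κ * ((N : ℝ) + l - N))⌋₊ : ℝ) ≤
      2 * u * r ^ l := fun l => by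
    have e1 : (2 : ℝ) ^ (-κ * ((N : ℝ) + l - N)) = r ^ l := by
      rw [hr, ← Real.rpow_mul_natCast zero_le_two]; ring_nf
    rw [e1, mul_assoc 2]
    exact mul_le_mul_of_nonneg_left (Nat.floor_le (show 0 ≤ u * r ^ l by positivity)) zero_le_two
  refine (Finset.sum_le_sum fun l _ => hterm l).trans ?_
  rw [← Finset.mul_sum]
  have hgeom : ∑ l ∈ Finset.range (J - N), r ^ l ≤ ∑' l : ℕ, r ^ l :=
    (summable_geometric_of_lt_one hr0.le hr1).sum_le_tsum _ fun l _ => by positivity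
  rw [tsum_geometric_of_lt_one hr0.le hr1] at hgeom
  refine (mul_le_mul_of_nonneg_left hgeom (by positivity)).trans (le_of_eq ?_)
  have : 1 - r ≠ 0 := by linarith
  rw [hu]
  field_simp
  norm_num

/-- The upper bound on `v` gives `2 ^ (-a * N) ≲ v ^ (-a) * (N + 1) ^ ((d - 1) * a)`. Both bounds on
`v` make `N + 1` and `log (2 * v)` comparable up to the factor `d + 2`, so the powers of `N + 1`
merge into the logarithm. -/
theorem level_estimates {d N v : ℕ} (hd : 1 ≤ d) (hv : 1 ≤ v) (h1 : 2 ^ N ≤ v)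
    (h2 : v < 2 * (2 ^ (N + 1) * (N + 2) ^ (d - 1))) {a : ℝ} (ha : 0 < a) (b : ℝ) :
    (2 : ℝ) ^ (-a * (N : ℝ)) * ((N : ℝ) + 1) ^ (((d : ℝ) - 1) * b) ≤
      (4 ^ a * 2 ^ (((d : ℝ) - 1) * a) * ((d : ℝ) + 2) ^ |((d : ℝ) - 1) * (a + b)|) *
        ((v : ℝ) ^ (-a) * Real.log (2 * v) ^ (((d : ℝ) - 1) * (a + b))) := by
  have hv' : (1 : ℝ) ≤ v := by exact_mod_cast hv
  have hv0 : (0 : ℝ) < v := by linarith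
  have hd' : (1 : ℝ) ≤ d := by exact_mod_cast hd
  have hN : (0 : ℝ) ≤ N := N.cast_nonneg
  have hcast : ((d - 1 : ℕ) : ℝ) = (d : ℝ) - 1 := by push_cast [hd]; ring
  have h2' : (v : ℝ) ≤ 4 * (2 : ℝ) ^ N * ((N : ℝ) + 2) ^ (d - 1) := by
    have : (v : ℝ) < 2 * (2 ^ (N + 1) * ((N : ℝ) + 2) ^ (d - 1)) := by exact_mod_cast h2
    refine this.le.trans (le_of_eq ?_)
    ring
  have h1' : (2 : ℝ) ^ N ≤ v := by exact_mod_cast h1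
  have hlog2 : (1 : ℝ) / 2 < Real.log 2 := by linarith [Real.log_two_gt_d9]
  have hlog2' : Real.log 2 < 1 := by linarith [Real.log_two_lt_d9]
  have hlogv : Real.log (2 * v) = Real.log 2 + Real.log v := Real.log_mul two_ne_zero hv0.ne'
  have hlow : ((N : ℝ) + 1) * Real.log 2 ≤ Real.log (2 * v) := by
    have := Real.log_le_log (by positivity) h1'
    rw [Real.log_pow] at this
    linarith
  have hup : Real.log (2 * v) ≤ ((N : ℝ) + 1) * (d + 2) := by
    have h3 : ((N : ℝ) + 2) ≤ 2 ^ (N + 1) := by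
      have : N + 1 + 1 ≤ 2 ^ (N + 1) := (N + 1).lt_two_pow_self
      exact_mod_cast this
    have h4 : 2 * (v : ℝ) ≤ 2 ^ (N + 3 + (N + 1) * (d - 1)) := by
      have h5 : ((N : ℝ) + 2) ^ (d - 1) ≤ (2 ^ (N + 1)) ^ (d - 1) :=
        pow_le_pow_left₀ (by positivity) h3 _
      have h6 := h2'.trans (mul_le_mul_of_nonneg_left h5 (by positivity))
      rw [pow_add, pow_add, pow_mul]
      linarith
    have h7 := Real.log_le_log (by positivity) h4
    rw [Real.log_pow] at h7
    push_cast at h7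
    rw [hcast] at h7
    have h8 : (0 : ℝ) ≤ (N : ℝ) + 3 + (N + 1) * (d - 1) := by nlinarith
    nlinarith [mul_le_mul_of_nonneg_left hlog2'.le h8]
  have hlogpos : 0 < Real.log (2 * v) := by nlinarith
  have e1 : (2 : ℝ) ^ (-a * (N : ℝ)) ≤
      4 ^ a * (v : ℝ) ^ (-a) * (2 ^ (((d : ℝ) - 1) * a) * ((N : ℝ) + 1) ^ (((d : ℝ) - 1) * a)) := by
    have h3 : (v : ℝ) / (4 * ((N : ℝ) + 2) ^ (d - 1)) ≤ (2 : ℝ) ^ N := by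
      rw [div_le_iff₀ (by positivity)]; linarith
    have h4 := Real.rpow_le_rpow_of_nonpos (by positivity) h3 (show -a ≤ 0 by linarith)
    have h5 : ((2 : ℝ) ^ N) ^ (-a) = (2 : ℝ) ^ (-a * (N : ℝ)) := by
      rw [← Real.rpow_natCast, ← Real.rpow_mul zero_le_two]; ring_nf
    rw [h5, Real.div_rpow hv0.le (by positivity), Real.rpow_neg (by positivity) a, Real.rpow_neg
      (by positivity) a, div_inv_eq_mul, Real.mul_rpow (by norm_num) (by positivity),
      ← Real.rpow_natCast, ← Real.rpow_mul (by positivity), hcast, ← Real.rpow_neg hv0.le] at h4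
    refine h4.trans ?_
    rw [← Real.mul_rpow zero_le_two (by positivity)]
    have h6 : ((N : ℝ) + 2) ^ (((d : ℝ) - 1) * a) ≤ (2 * ((N : ℝ) + 1)) ^ (((d : ℝ) - 1) * a) :=
      Real.rpow_le_rpow (by positivity) (by linarith) (mul_nonneg (by linarith) ha.le)
    calc _ = 4 ^ a * (v : ℝ) ^ (-a) * ((N : ℝ) + 2) ^ (((d : ℝ) - 1) * a) := by ring
      _ ≤ _ := mul_le_mul_of_nonneg_left h6 (by positivity)
  have e2 := rpow_le_mul_rpow_abs (x := (N : ℝ) + 1) (y := Real.log (2 * v)) (t := (d : ℝ) + 2)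
    (by positivity) hlogpos (by linarith) (by nlinarith) hup (((d : ℝ) - 1) * (a + b))
  have e3 : ((N : ℝ) + 1) ^ (((d : ℝ) - 1) * (a + b)) =
      ((N : ℝ) + 1) ^ (((d : ℝ) - 1) * a) * ((N : ℝ) + 1) ^ (((d : ℝ) - 1) * b) := by
    rw [← Real.rpow_add (by positivity)]; ring_nf
  calc _ ≤ 4 ^ a * (v : ℝ) ^ (-a) * (2 ^ (((d : ℝ) - 1) * a) *
        ((N : ℝ) + 1) ^ (((d : ℝ) - 1) * a)) * ((N : ℝ) + 1) ^ (((d : ℝ) - 1) * b) :=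
        mul_le_mul_of_nonneg_right e1 (by positivity)
    _ = 4 ^ a * 2 ^ (((d : ℝ) - 1) * a) * (v : ℝ) ^ (-a) *
        ((N : ℝ) + 1) ^ (((d : ℝ) - 1) * (a + b)) := by rw [e3]; ring
    _ ≤ 4 ^ a * 2 ^ (((d : ℝ) - 1) * a) * (v : ℝ) ^ (-a) *
        (Real.log (2 * v) ^ (((d : ℝ) - 1) * (a + b)) *
          ((d : ℝ) + 2) ^ |((d : ℝ) - 1) * (a + b)|) :=
        mul_le_mul_of_nonneg_left e2 (by positivity)
    _ = _ := by ring

theorem card_biUnion_hyperbolicLayer_le_rpow {d v : ℕ} (hv : 1 ≤ v) {s : ℝ} (hs : 0 ≤ s) :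
    (((Finset.range ⌈s * Real.logb 2 v⌉₊).biUnion (hyperbolicLayer d)).card : ℝ) ≤
      (v : ℝ) ^ ((s + 2) * d) := by
  rcases hv.eq_or_lt with rfl | hv
  · simp
  -- Now `logb 2 v ≥ 1`, so two extra units, one from the ceiling and one from `J + 1`, are absorbed
  -- by `2 * logb 2 v`. For `v = 1` the set is empty.
  have hv' : (2 : ℝ) ≤ v := by exact_mod_cast hv
  have hlog : 1 ≤ Real.logb 2 v := by
    rw [Real.le_logb_iff_rpow_le one_lt_two (by linarith), Real.rpow_one]
    exact hv'
  set J := ⌈s * Real.logb 2 v⌉₊ with hJ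
  have h1 : (J : ℝ) + 1 ≤ (s + 2) * Real.logb 2 v := by
    have := Nat.ceil_lt_add_one (mul_nonneg hs (by linarith : 0 ≤ Real.logb 2 v))
    rw [← hJ] at this
    linarith
  have h2 : (((Finset.range J).biUnion (hyperbolicLayer d)).card : ℝ) ≤ 2 ^ ((J + 1) * d) := by
    exact_mod_cast hyperbolicLayer_card_biUnion_le d J
  refine h2.trans ?_
  have h3 : (v : ℝ) = 2 ^ Real.logb 2 v :=
    (Real.rpow_logb zero_lt_two (by norm_num) (by linarith)).symm
  rw [← Real.rpow_natCast]
  conv_rhs => rw [h3]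
  rw [← Real.rpow_mul zero_le_two]
  refine Real.rpow_le_rpow_of_exponent_le one_le_two ?_
  push_cast
  have := mul_le_mul_of_nonneg_right h1 (show (0 : ℝ) ≤ d from d.cast_nonneg)
  linarith

/-! ### Choice of parameters and conclusion -/

theorem lemma5p2 (d : ℕ) (hd : 1 ≤ d) (p : ℝ≥0∞) [Fact (1 ≤ p)] (hp : 1 < p) (hp' : p ≠ ∞)
    (a β : ℝ) (ha : 0 < a) (hβ : 0 < β) (hβ' : β ≤ 1) :
    ∃ cstar : ℝ, 0 < cstar ∧ ∀ b : ℝ, ∃ C : ℝ, 0 < C ∧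
      ∀ (N : ℕ) (Ω : Set (EuclideanSpace ℝ (Fin N))) [CompactSpace Ω]
        (ψ : (Fin d → ℤ) → C(Ω, ℂ)), (∀ k x, ‖ψ k x‖ ≤ 1) →
      ∀ v : ℕ, 1 ≤ v →
      ∃ Q : Finset (Fin d → ℤ), (Q.card : ℝ) ≤ (v : ℝ) ^ cstar ∧
        ∀ (μ : Measure Ω) [IsProbabilityMeasure μ] (m : ℕ) (ξ : Fin m → Ω), 0 < m →
        ∃ S : GreedyScheme (Fin d → ℤ),
          ∀ f ∈ WClass a b β ψ, ∀ c, IsWRepresentation a b β ψ f c →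
            (∃ h, S.IsOutput p (measureXi μ ξ) ψ c h) ∧
            ∀ h, S.IsOutput p (measureXi μ ξ) ψ c h →
              h.support ⊆ Q ∧ h.support.card ≤ v ∧
              ‖ContinuousMap.toLp p (measureXi μ ξ) ℂ
                  (f - Finsupp.linearCombination ℂ ψ h)‖ ≤
                C * (v : ℝ) ^ (-a + 1 / min p.toReal 2 - 1 / β) *
                  (Real.log (2 * (v : ℝ))) ^ (((d : ℝ) - 1) * (a + b)) := by
  set q := min p.toReal 2 with hqdef
  have hP : 1 < p.toReal := by
    have := (ENNReal.toReal_lt_toReal ENNReal.one_ne_top hp').2 hp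
    simpa using this
  have hq : 1 < q := lt_min hP one_lt_two
  have hq2 : q ≤ 2 := min_le_right _ _
  have hq1 : 0 < q - 1 := by linarith
  have hd' : (1 : ℝ) ≤ d := by exact_mod_cast hd
  set K := 2 * (1 + p.toReal * Real.exp (p.toReal / 4)) with hK
  have hK0 : 0 < K := by positivity
  set θ := 1 / β - 1 / q with hθ
  have hθ0 : 0 < θ := by
    have h1 : 1 / q < 1 := by rw [div_lt_one (by linarith)]; exact hq
    have h2 : 1 ≤ 1 / β := by rw [le_div_iff₀ hβ]; linarith
    linarith
  have hθneg : 1 / q - 1 / β = -θ := by rw [hθ]; ring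
  set κ := a / (2 * θ) with hκ
  have hκ0 : 0 < κ := by positivity
  have hκθ : κ * θ = a / 2 := by rw [hκ]; field_simp
  set η : ℝ := (1 - (2 : ℝ) ^ (-κ)) / 4 with hη
  have hκ2 : (2 : ℝ) ^ (-κ) < 1 := Real.rpow_lt_one_of_one_lt_of_neg one_lt_two (by linarith)
  have hκ3 : 0 < (2 : ℝ) ^ (-κ) := by positivity
  have hη0 : 0 < η := by rw [hη]; linarith
  have hη1 : η ≤ 1 := by rw [hη]; linarith
  -- This exponent is fixed before `b`, since `J` depends only on `κ` and `v`.
  refine ⟨((1 + 1 / κ) + 2) * d, by positivity, fun b => ?_⟩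
  obtain ⟨S, hS0, hS⟩ := exists_sum_layer_le ha hκθ (((d : ℝ) - 1) * b)
  set D := 1 + (K * (q - 1) ^ (1 - q)) ^ (1 / q) * 2 ^ (1 / β - 1 / q) with hD
  have hD0 : 0 < D := by positivity
  set A := 4 ^ a * 2 ^ (((d : ℝ) - 1) * a) * ((d : ℝ) + 2) ^ |((d : ℝ) - 1) * (a + b)| with hA
  have hA0 : 0 < A := by positivity
  refine ⟨D * S * η ^ (-θ) * A, by positivity, fun n Ω _ ψ hψ v hv => ?_⟩
  have hv' : (1 : ℝ) ≤ v := by exact_mod_cast hv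
  have hv0 : (0 : ℝ) < v := by linarith
  obtain ⟨N, hN1, hN2, hN3⟩ := exists_level (d - 1) hv
  -- Since `N ≤ logb 2 v`, this gives `κ * (j - N) ≥ logb 2 v` for `j ≥ J`, which forces `w j ≤ 1`.
  set J := ⌈(1 + 1 / κ) * Real.logb 2 v⌉₊ with hJ
  set w : ℕ → ℝ := fun j => η * v * (2 : ℝ) ^ (-κ * ((j : ℝ) - N)) with hw
  have hlogv : 0 ≤ Real.logb 2 v := Real.logb_nonneg one_lt_two hv'
  have hNlog : (N : ℝ) ≤ Real.logb 2 v := by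
    rw [Real.le_logb_iff_rpow_le one_lt_two hv0, Real.rpow_natCast]
    exact_mod_cast hN2
  have hJle : (1 + 1 / κ) * Real.logb 2 v ≤ J := Nat.le_ceil _
  have hNJ : N ≤ J := by
    have h1 : 0 ≤ 1 / κ * Real.logb 2 v := by positivity
    have : (N : ℝ) ≤ J := by linarith
    exact_mod_cast this
  have hw0 : ∀ j, 0 < w j := fun j => by positivity
  have hwJ : ∀ j ≥ J, w j ≤ 1 := fun j hj => by
    have hj' : (J : ℝ) ≤ j := by exact_mod_cast hj
    have h1 : Real.logb 2 v ≤ κ * ((j : ℝ) - N) := by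
      have h2 : 1 / κ * Real.logb 2 v ≤ (j : ℝ) - N := by linarith
      have h3 := mul_le_mul_of_nonneg_left h2 hκ0.le
      have h4 : κ * (1 / κ * Real.logb 2 v) = Real.logb 2 v := by field_simp
      linarith
    have h5 : (v : ℝ) ≤ 2 ^ (κ * ((j : ℝ) - N)) :=
      (Real.logb_le_iff_le_rpow one_lt_two hv0).1 h1
    have h6 : (v : ℝ) * (2 : ℝ) ^ (-κ * ((j : ℝ) - N)) ≤ 1 := by
      rw [neg_mul, Real.rpow_neg zero_le_two, ← div_eq_mul_inv, div_le_one (by positivity)]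
      exact h5
    have h7 : w j = η * ((v : ℝ) * (2 : ℝ) ^ (-κ * ((j : ℝ) - N))) := by
      simp only [hw]; ring
    rw [h7]
    exact mul_le_one₀ hη1 (by positivity) h6
  refine ⟨(Finset.range J).biUnion (hyperbolicLayer d),
    card_biUnion_hyperbolicLayer_le_rpow hv (by positivity), fun μ _ m ξ hm => ?_⟩
  have hprob := isProbabilityMeasure_measureXi μ hm ξ
  refine ⟨hyperbolicScheme d N J w, fun f _ c hc => ⟨?_, fun h hh => ?_⟩⟩
  · exact GreedyScheme.exists_isOutput _ (fun j => hyperbolicLayer_nonempty hd _) ψ c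
  obtain ⟨hsup, hcard⟩ := hyperbolicScheme_support hNJ hh
  refine ⟨hsup, ?_, ?_⟩
  · have h1 : (2 : ℝ) * (∑ j ∈ Finset.range N, (hyperbolicLayer d j).card : ℕ) ≤ v := by
      exact_mod_cast (Nat.mul_le_mul_left 2 (sum_card_hyperbolicLayer_le hd N)).trans hN1
    have h2 := sum_floor_weights_le hκ0 N J v
    have h3 : (h.support.card : ℝ) ≤ (∑ j ∈ Finset.range N, (hyperbolicLayer d j).card : ℕ) +
        (∑ j ∈ Finset.Ico N J, 2 * ⌊w j⌋₊ : ℕ) := by exact_mod_cast hcard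
    have h4 : (h.support.card : ℝ) ≤ v := by linarith
    exact_mod_cast h4
  · refine hyperbolicScheme_error hq hq2 hK0 (Lp_smooth hp') hβ hβ' hNJ hw0 hwJ hψ hc.hasSum
      hc.layer_le (fun J' => ?_) hh
    rw [← hD]
    simp only [mul_assoc D, ← Finset.mul_sum, hθneg]
    have h1 := hS N J' (η * v) (by positivity)
    have h2 := level_estimates hd hv hN2 hN3 ha b
    rw [← hA] at h2
    have hv3 : (v : ℝ) ^ (-a + 1 / q - 1 / β) = (v : ℝ) ^ (-θ) * (v : ℝ) ^ (-a) := by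
      rw [← Real.rpow_add hv0, hθ]; ring_nf
    have hηv : (η * (v : ℝ)) ^ (-θ) = η ^ (-θ) * (v : ℝ) ^ (-θ) :=
      Real.mul_rpow hη0.le hv0.le
    rw [hηv] at h1
    calc _ ≤ D * (S * (η ^ (-θ) * (v : ℝ) ^ (-θ) * (2 : ℝ) ^ (-a * (N : ℝ)) *
          ((N : ℝ) + 1) ^ (((d : ℝ) - 1) * b))) := mul_le_mul_of_nonneg_left h1 hD0.le
      _ = D * S * η ^ (-θ) * (v : ℝ) ^ (-θ) * ((2 : ℝ) ^ (-a * (N : ℝ)) *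
          ((N : ℝ) + 1) ^ (((d : ℝ) - 1) * b)) := by ring
      _ ≤ D * S * η ^ (-θ) * (v : ℝ) ^ (-θ) * (A * ((v : ℝ) ^ (-a) *
          Real.log (2 * v) ^ (((d : ℝ) - 1) * (a + b)))) :=
          mul_le_mul_of_nonneg_left h2 (by positivity)
      _ = _ := by rw [hv3]; ring
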